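/- All graphs are finite, simple, undirected and connected. A graph is cubic if every vertex has degree $3$, and bridgeless if no edge is a bridge. A cubic graph is Tait-colorable if its edge set can be partitioned into three perfect matchings; a snark is a bridgeless cubic graph that is not Tait-colorable. For a graph $G=(V,E)$ that admits a perfect matching put $$\eta(G)=\min_{w}\frac{\max\{w(P): P \text{ a perfect matching of } G\}}{\max\{w(M): M\text{ a matching of } G\}},$$ where $w$ ranges over all functions $w:E\to[0,\infty)$ that are not identically zero and $w(F)=\sum_{e\in F}w(e)$. For a class $\mathcal G$ of graphs that admit perfect matchings put $\eta(\mathcal G)=\inf_{G\in\mathcal G}\eta(G)$. For $n\ge 3$ and $1\le k\le\lfloor (n-1)/2\rfloor$ the generalized Petersen graph $G(n,k)$ has vertices $u_i,v_i$ ($i\in\mathbb Z/n$) and edges $u_iu_{i+1}$, $u_iv_i$, $v_iv_{i+k}$; the Petersen graph is $R=G(5,2)$. Let $\mathcal S$ be the family of graphs $G$, each with a matching $M_G$, obtained recursively as follows, up to isomorphism. The Petersen graph $R$ with the matching $M_R=\{u_1v_1,u_3u_4,v_0v_2\}$ is in $\mathcal S$. If $H_1,H_2$ with matchings $M_{H_1},M_{H_2}$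 are (disjoint copies of) members of $\mathcal S$, and $uv\notin M_{H_1}$ is an edge of $H_1$ and $xy\notin M_{H_2}$ an edge of $H_2$ such that $u$ and $x$ are saturated by $M_{H_1}$ and $M_{H_2}$, respectively, while $v$ and $y$ are not, then the graph obtained from $H_1-uv$ and $H_2-xy$ by adding the edges $uy$ and $vx$, with the matching $M_{H_1}\cup M_{H_2}$, is in $\mathcal S$. **Theorem.** 1. Each of the following classes satisfies $\eta=1/3$, and the infimum is attained: the Tait-colorable graphs; the planar bridgeless cubic graphs; the hamiltonian cubic graphs; the generalized Petersen graphs. 2. $\mathcal S$ contains graphs of arbitrarily large order, and every member $G$ of $\mathcal S$ is a snark with $\eta(G)=1/3$; in particular $\eta(\mathcal S)=1/3$. 3. Every bipartite nonhamiltonian cubic graph is Tait-colorable, and the class $\mathcal B$ of these graphs satisfies $1/3\le\eta(\mathcal B)\le 1/2$; moreover some $G\in\mathcal B$ has $\eta(G)\le 1/2$. -/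

import Mathlib

open scoped NNReal

noncomputable section

/-- A finite simple undirected graph. -/
structure FinGraph where
  V : Type
  [fintype : Fintype V]
  [decEq : DecidableEq V]
  graph : SimpleGraph V

attribute [instance] FinGraph.fintype FinGraph.decEq

namespace CostOfPerfection

section Eta

variable {V : Type} (G : SimpleGraph V)

/-- The total weight of the edges of a subgraph `M`. -/
def weight (w : G.edgeSet → ℝ≥0) (M : G.Subgraph) : ℝ :=
  ∑ᶠ e ∈ {e : G.edgeSet | (e : Sym2 V) ∈ M.edgeSet}, (w e : ℝ)

/-- The weight of a maximum weight matching. -/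
def maxMatchingWeight (w : G.edgeSet → ℝ≥0) : ℝ :=
  sSup (weight G w '' {M | M.IsMatching})

/-- The weight of a maximum weight perfect matching. -/
def maxPerfectMatchingWeight (w : G.edgeSet → ℝ≥0) : ℝ :=
  sSup (weight G w '' {P | P.IsPerfectMatching})

/-- The ratios `w(P*) / w(M*)`, over all nonnegative weights that are not identically zero. -/
def ratios : Set ℝ :=
  {r | ∃ w : G.edgeSet → ℝ≥0, w ≠ 0 ∧
    r = maxPerfectMatchingWeight G w / maxMatchingWeight G w}

/-- The parameter `η(G)`. The infimum is a minimum as soon as `G` has an edge, see `eta_isLeast`. -/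
def eta : ℝ := sInf (ratios G)

/-- A maximum weight matching exists. -/
theorem maxMatchingWeight_isGreatest [Finite V] (w : G.edgeSet → ℝ≥0) :
    IsGreatest (weight G w '' {M | M.IsMatching}) (maxMatchingWeight G w) := by
  have hfin : (weight G w '' {M : G.Subgraph | M.IsMatching}).Finite := Set.toFinite _
  refine hfin.isCompact.isGreatest_sSup ⟨_, ⊥, ?_, rfl⟩
  intro v hv
  exact absurd hv (by simp)

/-- A maximum weight perfect matching exists if there is a perfect matching. -/
theorem maxPerfectMatchingWeight_isGreatest [Finite V] (w : G.edgeSet → ℝ≥0)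
    (h : ∃ P : G.Subgraph, P.IsPerfectMatching) :
    IsGreatest (weight G w '' {P | P.IsPerfectMatching}) (maxPerfectMatchingWeight G w) := by
  have hfin : (weight G w '' {M : G.Subgraph | M.IsPerfectMatching}).Finite := Set.toFinite _
  obtain ⟨P, hP⟩ := h
  exact hfin.isCompact.isGreatest_sSup ⟨_, P, hP, rfl⟩

theorem weight_smul [Finite V] (c : ℝ≥0) (w : G.edgeSet → ℝ≥0) (M : G.Subgraph) :
    weight G (c • w) M = c * weight G w M := by
  unfold weight
  rw [finsum_mem_eq_finite_toFinset_sum _ (Set.toFinite _),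
    finsum_mem_eq_finite_toFinset_sum _ (Set.toFinite _), Finset.mul_sum]
  simp

theorem continuous_weight [Finite V] (M : G.Subgraph) :
    Continuous fun w : G.edgeSet → ℝ≥0 => weight G w M := by
  unfold weight
  simp_rw [finsum_mem_eq_finite_toFinset_sum _ (Set.toFinite _)]
  fun_prop

theorem sSup_weight_smul [Finite V] (c : ℝ≥0) (w : G.edgeSet → ℝ≥0) (S : Set G.Subgraph) :
    sSup (weight G (c • w) '' S) = c * sSup (weight G w '' S) := by
  have := Real.sSup_smul_of_nonneg (a := (c : ℝ)) c.2 (weight G w '' S)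
  rw [smul_eq_mul] at this
  rw [← this]
  congr 1
  ext r
  simp [Set.mem_smul_set, weight_smul]

theorem continuous_sSup_weight [Finite V] (S : Set G.Subgraph) :
    Continuous fun w : G.edgeSet → ℝ≥0 => sSup (weight G w '' S) := by
  rcases S.eq_empty_or_nonempty with rfl | hS
  · simpa using continuous_const
  · have hfin : S.Finite := Set.toFinite _
    have hne : hfin.toFinset.Nonempty := by simpa using hS
    have : (fun w : G.edgeSet → ℝ≥0 => sSup (weight G w '' S)) =
        fun w => hfin.toFinset.sup' hne (fun M => weight G w M) := by
      funext w
      rw [Finset.sup'_eq_csSup_image]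
      simp
    rw [this]
    exact Continuous.finset_sup'_apply hne fun M _ => continuous_weight G M

theorem maxMatchingWeight_pos [Finite V] (w : G.edgeSet → ℝ≥0) (hw : w ≠ 0) :
    0 < maxMatchingWeight G w := by
  obtain ⟨e, he⟩ := Function.ne_iff.mp hw
  obtain ⟨e, hmem⟩ := e
  induction e with
  | h u v =>
    have huv : G.Adj u v := hmem
    refine lt_of_lt_of_le ?_ ((maxMatchingWeight_isGreatest G w).2
      ⟨G.subgraphOfAdj huv, SimpleGraph.Subgraph.IsMatching.subgraphOfAdj huv, rfl⟩)
    unfold weight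
    rw [finsum_mem_eq_finite_toFinset_sum _ (Set.toFinite _)]
    refine Finset.sum_pos' (fun _ _ => NNReal.coe_nonneg _) ⟨⟨s(u, v), hmem⟩, by simp, ?_⟩
    exact NNReal.coe_pos.mpr (pos_iff_ne_zero.mpr he)

/-- For a finite graph with at least one edge the minimum defining `η(G)` is attained. -/
theorem eta_isLeast [Finite V] (h : G.edgeSet.Nonempty) : IsLeast (ratios G) (eta G) := by
  have := Fintype.ofFinite G.edgeSet
  let f : (G.edgeSet → ℝ≥0) → ℝ :=
    fun w => maxPerfectMatchingWeight G w / maxMatchingWeight G w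
  let K : Set (G.edgeSet → ℝ≥0) := {w | ∑ e, w e = 1}
  have hK0 : ∀ w ∈ K, w ≠ 0 := by
    rintro w hw rfl
    simp [K] at hw
  have hKc : IsCompact K := by
    refine IsCompact.of_isClosed_subset
      (isCompact_univ_pi fun _ : G.edgeSet => isCompact_Icc (a := (0 : ℝ≥0)) (b := 1)) ?_ ?_
    · exact isClosed_eq (by fun_prop) continuous_const
    · intro w hw e _
      refine ⟨zero_le, ?_⟩
      rw [← show ∑ e, w e = 1 from hw]
      exact Finset.single_le_sum (fun _ _ => zero_le) (Finset.mem_univ e)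
  have hKn : K.Nonempty := by
    classical
    obtain ⟨e, he⟩ := h
    exact ⟨Pi.single ⟨e, he⟩ 1, by simp [K]⟩
  have hfc : ContinuousOn f K := by
    refine ContinuousOn.div (continuous_sSup_weight G _).continuousOn
      (continuous_sSup_weight G _).continuousOn ?_
    intro w hw
    exact (maxMatchingWeight_pos G w (hK0 w hw)).ne'
  have himg : ratios G = f '' K := by
    ext r
    constructor
    · rintro ⟨w, hw, rfl⟩
      have hs : ∑ e, w e ≠ 0 := by
        intro h0
        apply hw
        funext e
        simpa using (Finset.sum_eq_zero_iff.mp h0) e (Finset.mem_univ e)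
      refine ⟨(∑ e, w e)⁻¹ • w, ?_, ?_⟩
      · change ∑ e, ((∑ e, w e)⁻¹ • w) e = 1
        simp only [Pi.smul_apply, smul_eq_mul, ← Finset.mul_sum]
        exact inv_mul_cancel₀ hs
      · have hc : (((∑ e, w e)⁻¹ : ℝ≥0) : ℝ) ≠ 0 := by
          exact_mod_cast inv_ne_zero hs
        simp only [f, maxPerfectMatchingWeight, maxMatchingWeight, sSup_weight_smul]
        exact mul_div_mul_left _ _ hc
    · rintro ⟨w, hw, rfl⟩
      exact ⟨w, hK0 w hw, rfl⟩
  unfold eta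
  rw [himg]
  exact (hKc.image_of_continuousOn hfc).isLeast_sInf (hKn.image f)

end Eta

/-- The parameter `η` of a graph class: the infimum of `η(G)` over its members. -/
def classEta (C : Set FinGraph) : ℝ := sInf ((fun G : FinGraph => eta G.graph) '' C)

section Properties

variable {V : Type}

/-- A connected graph all of whose vertices have degree exactly three. -/
def IsConnectedCubic (G : SimpleGraph V) : Prop :=
  G.Connected ∧ ∀ v, (G.neighborSet v).ncard = 3

/-- No edge of the graph is a bridge. -/
def IsBridgeless (G : SimpleGraph V) : Prop := ∀ e ∈ G.edgeSet, ¬ G.IsBridge e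

/-- A connected cubic graph whose edges are partitioned into three perfect matchings. -/
def IsTaitColorable (G : SimpleGraph V) : Prop :=
  IsConnectedCubic G ∧ ∃ P : Fin 3 → G.Subgraph,
    (∀ i, (P i).IsPerfectMatching) ∧ ∀ e ∈ G.edgeSet, ∃! i, e ∈ (P i).edgeSet

/-- A snark: a connected bridgeless cubic graph that is not Tait-colorable. -/
def IsSnark (G : SimpleGraph V) : Prop :=
  IsConnectedCubic G ∧ IsBridgeless G ∧ ¬ IsTaitColorable G

/-- A drawing of a graph in the plane without crossings: vertices are distinct points, each edge
is a simple arc between its two ends, the interior of an arc contains no vertex, and the interiors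
of two distinct arcs are disjoint. -/
structure PlaneDrawing (G : SimpleGraph V) where
  pos : V → ℝ × ℝ
  pos_injective : Function.Injective pos
  arc : G.edgeSet → unitInterval → ℝ × ℝ
  arc_continuous : ∀ e, Continuous (arc e)
  arc_injective : ∀ e, Function.Injective (arc e)
  arc_ends : ∀ e : G.edgeSet, ∃ u v, (e : Sym2 V) = s(u, v) ∧ arc e 0 = pos u ∧ arc e 1 = pos v
  arc_ne_pos : ∀ e, ∀ t ∈ Set.Ioo (0 : unitInterval) 1, ∀ v, arc e t ≠ pos v
  arc_ne_arc : ∀ e f, e ≠ f → ∀ s ∈ Set.Ioo (0 : unitInterval) 1,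
    ∀ t ∈ Set.Ioo (0 : unitInterval) 1, arc e s ≠ arc f t

/-- A graph is planar if it has a plane drawing without crossings. -/
def IsPlanar (G : SimpleGraph V) : Prop := Nonempty (PlaneDrawing G)

end Properties

/-- The generalized Petersen graph `G(n, k)`, with `u i = Sum.inl i` and `v i = Sum.inr i`: its
edges are `u i – u (i + 1)`, `u i – v i` and `v i – v (i + k)`, with subscripts modulo `n`. -/
def genPetersen (n k : ℕ) : SimpleGraph (ZMod n ⊕ ZMod n) :=
  SimpleGraph.fromRel fun a b =>
    (∃ i, a = .inl i ∧ b = .inl (i + 1)) ∨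
    (∃ i, a = .inl i ∧ b = .inr i) ∨
    (∃ i, a = .inr i ∧ b = .inr (i + k))

/-- The Petersen graph `G(5, 2)`. -/
def petersen : SimpleGraph (ZMod 5 ⊕ ZMod 5) := genPetersen 5 2

/-- A maximal matching of the Petersen graph with three edges. The four vertices it leaves
unsaturated form an independent set; up to automorphism it is the only such matching. -/
def petersenMatching : Set (Sym2 (ZMod 5 ⊕ ZMod 5)) :=
  {s(.inl 1, .inr 1), s(.inl 3, .inl 4), s(.inr 0, .inr 2)}

/-- The vertex `v` is an end of an edge of `M`. -/
def Saturates {V : Type} (M : Set (Sym2 V)) (v : V) : Prop := ∃ e ∈ M, v ∈ e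

/-- Delete `uv` from `H₁` and `xy` from `H₂`, and join `u` with `y` and `v` with `x` in the
disjoint union. -/
def edgeJoin {V W : Type} (H₁ : SimpleGraph V) (H₂ : SimpleGraph W) (u v : V) (x y : W) :
    SimpleGraph (V ⊕ W) :=
  (H₁.deleteEdges {s(u, v)}).sum (H₂.deleteEdges {s(x, y)}) ⊔
    SimpleGraph.edge (.inl u) (.inr y) ⊔ SimpleGraph.edge (.inl v) (.inr x)

/-- The pairs `(G, M)` of a graph and a matching in it that are constructed from the Petersen
graph with its matching by repeatedly joining two constructed pairs along edges `uv`, `xy`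
outside the matchings, where `u`, `x` are saturated and `v`, `y` are not. -/
inductive Constructed : ∀ {V : Type}, SimpleGraph V → Set (Sym2 V) → Prop
  | base : Constructed petersen petersenMatching
  | join {V W : Type} {H₁ : SimpleGraph V} {H₂ : SimpleGraph W}
      {M₁ : Set (Sym2 V)} {M₂ : Set (Sym2 W)} {u v : V} {x y : W} :
      Constructed H₁ M₁ → Constructed H₂ M₂ →
      H₁.Adj u v → s(u, v) ∉ M₁ → Saturates M₁ u → ¬ Saturates M₁ v →
      H₂.Adj x y → s(x, y) ∉ M₂ → Saturates M₂ x → ¬ Saturates M₂ y →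
      Constructed (edgeJoin H₁ H₂ u v x y)
        (Sym2.map Sum.inl '' M₁ ∪ Sym2.map Sum.inr '' M₂)

/-- Tait-colorable graphs. -/
def taitColorableGraphs : Set FinGraph := {G | IsTaitColorable G.graph}

/-- Planar bridgeless cubic graphs. -/
def planarBridgelessCubicGraphs : Set FinGraph :=
  {G | IsConnectedCubic G.graph ∧ IsBridgeless G.graph ∧ IsPlanar G.graph}

/-- Hamiltonian cubic graphs. -/
def hamiltonianCubicGraphs : Set FinGraph :=
  {G | IsConnectedCubic G.graph ∧ G.graph.IsHamiltonian}

/-- Generalized Petersen graphs, up to isomorphism. -/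
def generalizedPetersenGraphs : Set FinGraph :=
  {G | ∃ n k : ℕ, 3 ≤ n ∧ 1 ≤ k ∧ k ≤ (n - 1) / 2 ∧ Nonempty (G.graph ≃g genPetersen n k)}

/-- The graphs constructed from the Petersen graph, up to isomorphism. -/
def petersenSnarkFamily : Set FinGraph :=
  {G | ∃ (V : Type) (H : SimpleGraph V) (M : Set (Sym2 V)),
    Constructed H M ∧ Nonempty (G.graph ≃g H)}

/-- Bipartite nonhamiltonian cubic graphs. -/
def bipartiteNonhamiltonianCubicGraphs : Set FinGraph :=
  {G | IsConnectedCubic G.graph ∧ G.graph.IsBipartite ∧ ¬ G.graph.IsHamiltonian}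

/-- `η(C) = r`, and the minimum over the class is attained. -/
def ClassEtaEq (C : Set FinGraph) (r : ℝ) : Prop :=
  classEta C = r ∧ IsLeast ((fun G : FinGraph => eta G.graph) '' C) r

end CostOfPerfection

end

/-! Lower bounds. Suppose the vector with value 1/3 on every edge of a cubic graph is a convex
combination of perfect matchings. Then for each weight `w` some perfect matching weighs at least the
average `w(E)/3`, hence at least a third of any matching (`third_le_eta`). The three classes of a
Tait coloring are such a combination. For bridgeless cubic graphs it comes from Edmonds' polytope
theorem (`IsFracPM.isMix`): by the degree sum the number of edges leaving an odd vertex set is odd,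
and it is not 1, so it is at least 3. This covers planar, hamiltonian and generalized Petersen
graphs as well as the snarks.

Edmonds' theorem is proved by induction on the number of vertices and then on the support. Tutte's
theorem puts a perfect matching inside the support of `x`; as much of it as possible is subtracted.
Either the support shrinks, or some odd cut becomes tight. In the second case each side of the cut
is shrunk to a point, and the two combinations obtained by induction are glued along the cut
(`isMix_of_shrink`).

Upper bounds. Give weight 1 to a matching `M` that covers 3/5 of the vertices and leaves an
independent set. A perfect matching sends the uncovered 2/5 into covered vertices, so at most 1/5 of
all vertices keep their partner in `M`: a third of `M` (`IsSparseMaximal.eta_le`). The Petersen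
graph has such a matching, and so has `chordGraph`, which is at once planar, hamiltonian and
Tait-colorable. Joining preserves the matching, bridgelessness and, by the parity lemma, the absence
of a 3-edge-coloring.

Bipartite graphs. Cubic ones are Tait-colorable by removing perfect matchings. In `tripleLink` every
perfect matching uses the same copy at both hubs; this excludes a Hamiltonian cycle and yields a
two-edge matching of which at most one edge can be used. -/

noncomputable section

namespace CostOfPerfection

/-! ### Fractional perfect matchings and Tutte's theorem -/

section Fractional

variable {V : Type} [Fintype V] [DecidableEq V]

/-- The total value of the pairs that leave `A`. -/
def cut (x : V → V → ℝ) (A : Finset V) : ℝ := ∑ a ∈ A, ∑ b ∈ Aᶜ, x a b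

/-- The constraints of the perfect matching polytope of the complete graph on `V`. -/
structure IsFracPM (x : V → V → ℝ) : Prop where
  nonneg : ∀ a b, 0 ≤ x a b
  symm : ∀ a b, x a b = x b a
  diag : ∀ a, x a a = 0
  row : ∀ a, ∑ b, x a b = 1
  odd : ∀ A : Finset V, Odd A.card → 1 ≤ cut x A

/-- A fixed point free involution, viewed as a perfect matching. -/
def IsPairing (σ : V → V) : Prop := ∀ v, σ v ≠ v ∧ σ (σ v) = v

/-- `x` is a nonnegative combination of the incidence vectors of perfect matchings. -/
def IsMix (x : V → V → ℝ) : Prop :=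
  ∃ (ι : Type) (_ : Fintype ι) (σ : ι → V → V) (c : ι → ℝ), (∀ i, IsPairing (σ i)) ∧
    (∀ i, 0 ≤ c i) ∧ ∀ a b, ∑ i, (if σ i a = b then c i else 0) = x a b

theorem cut_compl {x : V → V → ℝ} (hx : ∀ a b, x a b = x b a) (A : Finset V) :
    cut x Aᶜ = cut x A := by
  unfold cut
  rw [compl_compl, Finset.sum_comm]
  simp_rw [hx]

theorem cut_singleton {x : V → V → ℝ} (hx : ∀ a, x a a = 0) (a : V) :
    cut x {a} = ∑ b, x a b := by
  unfold cut
  rw [Finset.sum_singleton, ← Finset.sum_add_sum_compl {a} (fun b => x a b)]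
  simp [hx]

/-- The perfect matching given by Tutte's theorem inside the support of `x`. -/
theorem IsFracPM.exists_pairing {x : V → V → ℝ} (hx : IsFracPM x) :
    ∃ σ : V → V, IsPairing σ ∧ ∀ v, 0 < x v (σ v) := by
  classical
  let G : SimpleGraph V :=
    { Adj := fun a b => 0 < x a b
      symm := ⟨fun a b h => by rwa [hx.symm]⟩
      loopless := ⟨fun a h => by simp [hx.diag] at h⟩ }
  have key : ∃ M : G.Subgraph, M.IsPerfectMatching := by
    rw [SimpleGraph.tutte]
    intro u hu
    unfold SimpleGraph.IsTutteViolator at hu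
    set H := ((⊤ : G.Subgraph).deleteVerts u).coe with hH
    let A : H.ConnectedComponent → Finset V := fun C =>
      Finset.univ.filter fun v => ∃ h, H.connectedComponentMk ⟨v, h⟩ = C
    have hcard : ∀ C, (A C).card = C.supp.ncard := by
      intro C
      have : (A C : Set V) = Subtype.val '' C.supp := by
        ext v
        simp [A]
      rw [← Set.ncard_coe_finset, this, Set.ncard_image_of_injective _ Subtype.val_injective]
    have hdisj : ∀ C D, C ≠ D → Disjoint (A C) (A D) := by
      intro C D hCD
      rw [Finset.disjoint_left]
      intro v hv hv'
      simp only [A, Finset.mem_filter, Finset.mem_univ, true_and] at hv hv'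
      obtain ⟨h, rfl⟩ := hv
      obtain ⟨h', rfl⟩ := hv'
      exact hCD rfl
    -- All value leaving an odd component of the graph without `u` ends in `u`. Since `u` receives
    -- exactly 1 per vertex, there are at most `|u|` odd components and `u` is no Tutte violator.
    have hcut : ∀ C ∈ H.oddComponents, 1 ≤ ∑ a ∈ A C, ∑ b ∈ u.toFinset, x a b := by
      intro C hC
      have h1 := hx.odd (A C) (by rw [hcard]; exact hC)
      refine h1.trans (Finset.sum_le_sum fun a ha => ?_)
      rw [← Finset.sum_filter_add_sum_filter_not (A C)ᶜ (fun b => b ∈ u)]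
      have h0 : ∑ b ∈ (A C)ᶜ with b ∉ u, x a b = 0 := by
        refine Finset.sum_eq_zero fun b hb => ?_
        simp only [Finset.mem_filter, Finset.mem_compl] at hb
        by_contra hne
        have hab : G.Adj a b := lt_of_le_of_ne (hx.nonneg a b) (Ne.symm hne)
        simp only [A, Finset.mem_filter, Finset.mem_univ, true_and] at ha hb
        obtain ⟨hau, rfl⟩ := ha
        apply hb.1
        have hbu : b ∈ ((⊤ : G.Subgraph).deleteVerts u).verts := by simp [hb.2]
        refine ⟨hbu, ?_⟩
        rw [SimpleGraph.ConnectedComponent.eq]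
        apply SimpleGraph.Adj.reachable
        have hau' : a ∉ u := by simpa using hau
        simp [hH, hab.symm, hau', hb.2]
      rw [h0, add_zero]
      refine Finset.sum_le_sum_of_subset_of_nonneg ?_ fun b _ _ => hx.nonneg a b
      intro b hb
      simpa using (Finset.mem_filter.mp hb).2
    have hfin : H.oddComponents.Finite := Set.toFinite _
    have hle : (H.oddComponents.ncard : ℝ) ≤ u.ncard := by
      calc (H.oddComponents.ncard : ℝ) = ∑ C ∈ hfin.toFinset, (1 : ℝ) := by
            rw [Set.ncard_eq_toFinset_card _ hfin]; simp
        _ ≤ ∑ C ∈ hfin.toFinset, ∑ a ∈ A C, ∑ b ∈ u.toFinset, x a b :=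
            Finset.sum_le_sum fun C hC => hcut C (by simpa using hC)
        _ = ∑ a ∈ hfin.toFinset.biUnion A, ∑ b ∈ u.toFinset, x a b := by
            rw [Finset.sum_biUnion]
            intro C _ D _ hCD
            exact hdisj C D hCD
        _ ≤ ∑ a, ∑ b ∈ u.toFinset, x a b :=
            Finset.sum_le_sum_of_subset_of_nonneg (Finset.subset_univ _) fun a _ _ =>
              Finset.sum_nonneg fun b _ => hx.nonneg a b
        _ = ∑ b ∈ u.toFinset, ∑ a, x a b := Finset.sum_comm
        _ = ∑ b ∈ u.toFinset, 1 := by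
            refine Finset.sum_congr rfl fun b _ => ?_
            rw [← hx.row b]
            exact Finset.sum_congr rfl fun a _ => hx.symm a b
        _ = u.ncard := by rw [Set.ncard_eq_toFinset_card']; simp
    exact absurd hu (not_lt.mpr (by exact_mod_cast hle))
  obtain ⟨M, hM⟩ := key
  rw [SimpleGraph.Subgraph.isPerfectMatching_iff] at hM
  choose σ hσ hu using hM
  refine ⟨σ, fun v => ⟨fun h => ?_, (hu _ _ (hσ v).symm).symm⟩, fun v => (hσ v).adj_sub⟩
  exact (hσ v).adj_sub.ne h.symm

end Fractional

/-! ### Contraction along tight odd cuts -/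

/-- Shrink the complement of `A` to the single vertex `none`. -/
def shrink {V : Type} [DecidableEq V] (A : Finset V) (v : V) : Option A :=
  if h : v ∈ A then some ⟨v, h⟩ else none

theorem shrink_eq_none {V : Type} [DecidableEq V] (A : Finset V) (v : V) :
    shrink A v = none ↔ v ∉ A := by
  unfold shrink
  split_ifs with h <;> simp [h]

theorem shrink_eq_some {V : Type} [DecidableEq V] (A : Finset V) (v : V) (a : A) :
    shrink A v = some a ↔ v = a := by
  unfold shrink
  split_ifs with h
  · simp [Subtype.ext_iff]
  · simp only [false_iff]
    rintro rfl
    exact h a.2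

section Contraction

variable {V W : Type} [Fintype V] [DecidableEq V] [Fintype W] [DecidableEq W]

/-- The values between the fibres of `π`. -/
def contract (x : V → V → ℝ) (π : V → W) (b c : W) : ℝ :=
  if b = c then 0 else ∑ v with π v = b, ∑ w with π w = c, x v w

theorem cut_contract (x : V → V → ℝ) (π : V → W) (B : Finset W) :
    cut (contract x π) B = cut x (Finset.univ.filter fun v => π v ∈ B) := by
  have hsum : ∀ (T : Finset W) (f : V → ℝ),
      ∑ v with π v ∈ T, f v = ∑ c ∈ T, ∑ v with π v = c, f v := by
    intro T f
    rw [← Finset.sum_fiberwise_of_maps_to (s := Finset.univ.filter fun v => π v ∈ T) (t := T)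
      (g := π) (by simp)]
    refine Finset.sum_congr rfl fun c hc => Finset.sum_congr ?_ fun _ _ => rfl
    ext v
    simp only [Finset.mem_filter, Finset.mem_univ, true_and]
    constructor
    · exact fun h => h.2
    · rintro rfl
      exact ⟨hc, rfl⟩
  have hc : (Finset.univ.filter fun v => π v ∈ B)ᶜ = Finset.univ.filter fun v => π v ∈ Bᶜ := by
    ext v
    simp
  unfold cut
  rw [hc, hsum B]
  refine Finset.sum_congr rfl fun b hb => ?_
  simp_rw [hsum Bᶜ]
  rw [Finset.sum_comm]
  refine Finset.sum_congr rfl fun c hc => ?_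
  have hbc : b ≠ c := by
    rintro rfl
    exact (Finset.mem_compl.mp hc) hb
  simp [contract, hbc]

/-- Tightness of the fibres gives the row sums. An odd set of fibres has an odd preimage because all
fibres are odd, so its cut constraint is one for `x`. -/
theorem IsFracPM.contract {x : V → V → ℝ} (hx : IsFracPM x) (π : V → W)
    (hodd : ∀ b, Odd (Finset.univ.filter fun v => π v = b).card)
    (htight : ∀ b, cut x (Finset.univ.filter fun v => π v = b) = 1) :
    IsFracPM (contract x π) where
  nonneg b c := by
    unfold CostOfPerfection.contract
    split_ifs
    · exact le_rfl
    · exact Finset.sum_nonneg fun _ _ => Finset.sum_nonneg fun _ _ => hx.nonneg _ _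
  symm b c := by
    unfold CostOfPerfection.contract
    by_cases h : b = c
    · simp [h]
    · rw [if_neg h, if_neg (Ne.symm h), Finset.sum_comm]
      simp_rw [hx.symm]
  diag b := by simp [CostOfPerfection.contract]
  row b := by
    rw [← cut_singleton (by simp [CostOfPerfection.contract]), cut_contract, ← htight b]
    simp
  odd B hB := by
    rw [cut_contract]
    apply hx.odd
    have : (Finset.univ.filter fun v => π v ∈ B).card =
        ∑ b ∈ B, (Finset.univ.filter fun v => π v = b).card := by
      rw [Finset.card_eq_sum_card_fiberwise (f := π) (t := B) (by intro v; simp)]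
      refine Finset.sum_congr rfl fun b hb => ?_
      congr 1
      ext v
      simp only [Finset.mem_filter, Finset.mem_univ, true_and]
      constructor
      · exact fun h => h.2
      · rintro rfl
        exact ⟨hb, rfl⟩
    rw [this, Finset.odd_sum_iff_odd_card_odd]
    simpa [hodd] using hB

theorem IsFracPM.even_card {x : V → V → ℝ} (hx : IsFracPM x) : Even (Fintype.card V) := by
  by_contra h
  have := hx.odd Finset.univ (by rwa [Finset.card_univ, ← Nat.not_even_iff_odd])
  simp [cut] at this
  linarith

theorem IsFracPM.shrink {x : V → V → ℝ} (hx : IsFracPM x) {A : Finset V} (hA : Odd A.card)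
    (ht : cut x A = 1) : IsFracPM (CostOfPerfection.contract x (shrink A)) := by
  have hnone : (Finset.univ.filter fun v => CostOfPerfection.shrink A v = none) = Aᶜ := by
    ext v
    simp [shrink_eq_none]
  have hsome : ∀ a : A,
      (Finset.univ.filter fun v => CostOfPerfection.shrink A v = some a) = {(a : V)} := by
    intro a
    ext v
    simp [shrink_eq_some]
  have hcard := Finset.card_compl_add_card A
  refine hx.contract _ ?_ ?_
  · rintro (_ | a)
    · rw [hnone]
      -- The number of vertices is even, so the complement of the odd set `A` is an odd fibre.
      have := hx.even_card
      rw [← hcard] at this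
      grind
    · simp [hsome]
  · rintro (_ | a)
    · rw [hnone, cut_compl hx.symm, ht]
    · rw [hsome, cut_singleton hx.diag, hx.row]

theorem contract_shrink_some_some (x : V → V → ℝ) (hx : ∀ a, x a a = 0) (A : Finset V) (a b : A) :
    contract x (shrink A) (some a) (some b) = x a b := by
  unfold contract
  split_ifs with h
  · simp only [Option.some.injEq] at h
    rw [h, hx]
  · simp [shrink_eq_some, Finset.filter_eq']

theorem contract_shrink_some_none (x : V → V → ℝ) (A : Finset V) (a : A) :
    contract x (shrink A) (some a) none = ∑ w ∈ Aᶜ, x a w := by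
  have hnone : (Finset.univ.filter fun v => CostOfPerfection.shrink A v = none) = Aᶜ := by
    ext v
    simp [shrink_eq_none]
  simp [contract, shrink_eq_some, Finset.filter_eq', hnone]

end Contraction

/-! ### Gluing perfect matchings across a tight cut -/

section Gluing

variable {V : Type} [Fintype V] [DecidableEq V]

/-- Combine a perfect matching of the graph with `Aᶜ` shrunk and one of the graph with `A` shrunk:
the two vertices matched to the shrunk ones are matched to each other. -/
def glue (A : Finset V) (σ : Option A → Option A)
    (τ : Option (Aᶜ : Finset V) → Option (Aᶜ : Finset V)) (v : V) : V :=
  if h : v ∈ A then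
    match σ (some ⟨v, h⟩) with
    | some a => a
    | none => match τ none with
      | some b => b
      -- A default only: a pairing does not fix `none`. The same holds in the outer branch.
      | none => v
  else
    match τ (some ⟨v, Finset.mem_compl.mpr h⟩) with
    | some b => b
    | none => match σ none with
      | some a => a
      | none => v

/-- Change of density: `d` has image measure `s` under `w`, and weighting by `y / s` turns it into
`y`. Where `s` vanishes so does `y`, so that division by zero does no harm. -/
theorem sum_reweight {J B : Type} [Fintype J] [Fintype B] [DecidableEq B] (w : J → B) (d : J → ℝ)
    (s y : B → ℝ) (hs : ∀ b, ∑ j, (if w j = b then d j else 0) = s b)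
    (hy : ∀ b, s b = 0 → y b = 0) : ∑ j, d j * (y (w j) / s (w j)) = ∑ b, y b := by
  have : ∀ j, d j * (y (w j) / s (w j)) =
      ∑ b, (if w j = b then d j else 0) * (y b / s b) := by
    intro j
    simp
  simp_rw [this]
  rw [Finset.sum_comm]
  refine Finset.sum_congr rfl fun b _ => ?_
  rw [← Finset.sum_mul, hs]
  by_cases h : s b = 0
  · simp [h, hy b h]
  · field_simp

section

variable {A : Finset V} {σ : Option A → Option A}
  {τ : Option (Aᶜ : Finset V) → Option (Aᶜ : Finset V)} {u : A} {w : (Aᶜ : Finset V)}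

theorem glue_inside (hσ : IsPairing σ) (hu : σ none = some u) (hw : τ none = some w) (a : A) :
    (∃ b, σ (some a) = some b ∧ glue A σ τ a = b) ∨ (a = u ∧ glue A σ τ a = w) := by
  unfold glue
  rw [dif_pos a.2]
  rcases h : σ (some a) with _ | b
  · right
    have := (hσ (some a)).2
    rw [h, hu] at this
    refine ⟨(Option.some.inj this).symm, ?_⟩
    simp [hw]
  · exact Or.inl ⟨b, rfl, by simp⟩

theorem glue_outside (hτ : IsPairing τ) (hu : σ none = some u) (hw : τ none = some w)
    (a : (Aᶜ : Finset V)) :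
    (∃ b, τ (some a) = some b ∧ glue A σ τ a = b) ∨ (a = w ∧ glue A σ τ a = u) := by
  unfold glue
  rw [dif_neg (Finset.mem_compl.mp a.2)]
  rcases h : τ (some a) with _ | b
  · right
    have := (hτ (some a)).2
    rw [h, hw] at this
    refine ⟨(Option.some.inj this).symm, ?_⟩
    simp [hu]
  · exact Or.inl ⟨b, rfl, by simp⟩

theorem glue_inside_inside (hσ : IsPairing σ) (hu : σ none = some u) (hw : τ none = some w)
    (a b : A) : glue A σ τ a = b ↔ σ (some a) = some b := by
  rcases glue_inside hσ hu hw a with ⟨c, hc, hg⟩ | ⟨rfl, hg⟩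
  · rw [hg, hc, Option.some.injEq, Subtype.ext_iff]
  · have h1 := (hσ none).2
    rw [hu] at h1
    rw [hg, h1]
    simp only [reduceCtorEq, iff_false]
    intro h
    exact (Finset.mem_compl.mp w.2) (h ▸ b.2)

theorem glue_inside_outside (hσ : IsPairing σ) (hu : σ none = some u) (hw : τ none = some w)
    (a : A) (b : (Aᶜ : Finset V)) : glue A σ τ a = b ↔ u = a ∧ w = b := by
  rcases glue_inside hσ hu hw a with ⟨c, hc, hg⟩ | ⟨rfl, hg⟩
  · rw [hg]
    constructor
    · intro h
      exact absurd (h ▸ c.2) (Finset.mem_compl.mp b.2)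
    · rintro ⟨rfl, rfl⟩
      have h1 := (hσ none).2
      rw [hu, hc] at h1
      simp at h1
  · rw [hg, Subtype.ext_iff (a1 := w)]
    exact (and_iff_right rfl).symm

theorem glue_outside_outside (hτ : IsPairing τ) (hu : σ none = some u) (hw : τ none = some w)
    (a b : (Aᶜ : Finset V)) : glue A σ τ a = b ↔ τ (some a) = some b := by
  rcases glue_outside hτ hu hw a with ⟨c, hc, hg⟩ | ⟨rfl, hg⟩
  · rw [hg, hc, Option.some.injEq, Subtype.ext_iff]
  · have h1 := (hτ none).2
    rw [hw] at h1
    rw [hg, h1]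
    simp only [reduceCtorEq, iff_false]
    intro h
    exact (Finset.mem_compl.mp b.2) (h ▸ u.2)

theorem glue_outside_inside (hτ : IsPairing τ) (hu : σ none = some u) (hw : τ none = some w)
    (a : (Aᶜ : Finset V)) (b : A) : glue A σ τ a = b ↔ u = b ∧ w = a := by
  rcases glue_outside hτ hu hw a with ⟨c, hc, hg⟩ | ⟨rfl, hg⟩
  · rw [hg]
    constructor
    · intro h
      exact absurd (h ▸ b.2) (Finset.mem_compl.mp c.2)
    · rintro ⟨rfl, rfl⟩
      have h1 := (hτ none).2
      rw [hw, hc] at h1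
      simp at h1
  · rw [hg, Subtype.ext_iff (a1 := u)]
    exact (and_iff_left rfl).symm

theorem IsPairing.glue (hσ : IsPairing σ) (hτ : IsPairing τ) (hu : σ none = some u)
    (hw : τ none = some w) : IsPairing (glue A σ τ) := by
  intro v
  by_cases hv : v ∈ A
  · rcases glue_inside hσ hu hw ⟨v, hv⟩ with ⟨c, hc, hg⟩ | ⟨h, hg⟩
    · simp only at hg
      rw [hg]
      constructor
      · intro h
        apply (hσ (some ⟨v, hv⟩)).1
        rw [hc, Option.some.injEq]
        exact Subtype.ext h
      · have := (hσ (some ⟨v, hv⟩)).2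
        rw [hc] at this
        exact (glue_inside_inside hσ hu hw c ⟨v, hv⟩).mpr this
    · simp only at hg
      rw [hg]
      constructor
      · rintro rfl
        exact (Finset.mem_compl.mp w.2) hv
      · exact (glue_outside_inside hτ hu hw w ⟨v, hv⟩).mpr ⟨h.symm, rfl⟩
  · have hv' := Finset.mem_compl.mpr hv
    rcases glue_outside hτ hu hw ⟨v, hv'⟩ with ⟨c, hc, hg⟩ | ⟨h, hg⟩
    · simp only at hg
      rw [hg]
      constructor
      · intro h
        apply (hτ (some ⟨v, hv'⟩)).1
        rw [hc, Option.some.injEq]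
        exact Subtype.ext h
      · have := (hτ (some ⟨v, hv'⟩)).2
        rw [hc] at this
        exact (glue_outside_outside hτ hu hw c ⟨v, hv'⟩).mpr this
    · simp only at hg
      rw [hg]
      constructor
      · rintro rfl
        exact hv u.2
      · exact (glue_inside_outside hσ hu hw u ⟨v, hv'⟩).mpr ⟨rfl, h.symm⟩

end

theorem IsPairing.eq_comm_apply {V : Type} {σ : V → V} (hσ : IsPairing σ) (a b : V) :
    σ a = b ↔ σ b = a := by
  constructor
  · rintro rfl
    exact (hσ a).2
  · rintro rfl
    exact (hσ b).2

/-- Each matching of one side selects one end of a cut edge. Two matchings are combined with a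
weight proportional to the value of `x` on the cut edge selected by both; the weights are normalized
so that the marginals are the two given combinations. -/
theorem isMix_of_shrink {x : V → V → ℝ} (hx : IsFracPM x) (A : Finset V)
    (h₁ : IsMix (contract x (shrink A))) (h₂ : IsMix (contract x (shrink Aᶜ))) : IsMix x := by
  obtain ⟨ι, _, σ, c, hσ, hc, hcx⟩ := h₁
  obtain ⟨κ, _, τ, d, hτ, hd, hdx⟩ := h₂
  have hu : ∀ i, ∃ u, σ i none = some u := fun i => Option.ne_none_iff_exists'.mp (hσ i none).1
  have hw : ∀ j, ∃ w, τ j none = some w := fun j => Option.ne_none_iff_exists'.mp (hτ j none).1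
  choose u hu using hu
  choose w hw using hw
  -- `r` and `s` are the values sent across the cut by each vertex. They are also the total
  -- coefficients of the matchings that join this vertex to the shrunk side.
  set r : A → ℝ := fun a => ∑ b : (Aᶜ : Finset V), x a b with hr
  set s : (Aᶜ : Finset V) → ℝ := fun b => ∑ a : A, x a b with hs
  have hcr : ∀ a, ∑ i, (if u i = a then c i else 0) = r a := by
    intro a
    have h := hcx (some a) none
    rw [contract_shrink_some_none] at h
    simp only [hr]
    rw [Finset.sum_coe_sort (Aᶜ) (fun b => x a b), ← h]
    refine Finset.sum_congr rfl fun i _ => ?_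
    simp only [(hσ i).eq_comm_apply (some a) none, hu, Option.some.injEq]
  have hds : ∀ b, ∑ j, (if w j = b then d j else 0) = s b := by
    intro b
    have h := hdx (some b) none
    rw [contract_shrink_some_none, compl_compl] at h
    simp only [hs]
    rw [Finset.sum_coe_sort A (fun a => x a b)]
    simp_rw [fun a => hx.symm a b]
    rw [← h]
    refine Finset.sum_congr rfl fun j _ => ?_
    simp only [(hτ j).eq_comm_apply (some b) none, hw, Option.some.injEq]
  have hr0 : ∀ (a : A) (b : (Aᶜ : Finset V)), r a = 0 → x a b = 0 := fun a b h =>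
    (Finset.sum_eq_zero_iff_of_nonneg fun b _ => hx.nonneg _ _).mp h b (Finset.mem_univ b)
  have hs0 : ∀ (a : A) (b : (Aᶜ : Finset V)), s b = 0 → x a b = 0 := fun a b h =>
    (Finset.sum_eq_zero_iff_of_nonneg fun a _ => hx.nonneg _ _).mp h a (Finset.mem_univ a)
  have hc0 : ∀ i, r (u i) = 0 → c i = 0 := by
    intro i h
    rw [← hcr, Finset.sum_eq_zero_iff_of_nonneg] at h
    · simpa using h i (Finset.mem_univ i)
    · intro j _
      split_ifs
      exacts [hc j, le_rfl]
  have hd0 : ∀ j, s (w j) = 0 → d j = 0 := by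
    intro i h
    rw [← hds, Finset.sum_eq_zero_iff_of_nonneg] at h
    · simpa using h i (Finset.mem_univ i)
    · intro j _
      split_ifs
      exacts [hd j, le_rfl]
  have hrn : ∀ a, 0 ≤ r a := fun a => Finset.sum_nonneg fun _ _ => hx.nonneg _ _
  have hsn : ∀ a, 0 ≤ s a := fun a => Finset.sum_nonneg fun _ _ => hx.nonneg _ _
  -- Conditionally on the cut edge the two sides are independent. `hC₁` and `hC₂` compute the
  -- marginals, which settle pairs inside `A` and inside `Aᶜ`; `hC₃` settles the cut edges.
  let C : ι × κ → ℝ := fun p => c p.1 / r (u p.1) * (d p.2 / s (w p.2)) * x (u p.1) (w p.2)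
  have hC₁ : ∀ i, ∑ j, C (i, j) = c i := by
    intro i
    have := sum_reweight w d s (fun b => x (u i) b) hds (hs0 (u i))
    simp only [C]
    calc _ = c i / r (u i) * ∑ j, d j * (x (u i) (w j) / s (w j)) := by
          rw [Finset.mul_sum]
          exact Finset.sum_congr rfl fun j _ => by ring
      _ = c i / r (u i) * r (u i) := by rw [this]
      _ = c i := by
          by_cases h : r (u i) = 0
          · simp [h, hc0 i h]
          · field_simp
  have hC₂ : ∀ j, ∑ i, C (i, j) = d j := by
    intro j
    have := sum_reweight u c r (fun a => x a (w j)) hcr (fun a => hr0 a (w j))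
    simp only [C]
    calc _ = d j / s (w j) * ∑ i, c i * (x (u i) (w j) / r (u i)) := by
          rw [Finset.mul_sum]
          exact Finset.sum_congr rfl fun j _ => by ring
      _ = d j / s (w j) * s (w j) := by rw [this]
      _ = d j := by
          by_cases h : s (w j) = 0
          · simp [h, hd0 j h]
          · field_simp
  have hC₃ : ∀ a b, ∑ i, ∑ j, (if u i = a ∧ w j = b then C (i, j) else 0) = x a b := by
    intro a b
    have : ∀ i j, (if u i = a ∧ w j = b then C (i, j) else 0) =
        ((if u i = a then c i else 0) * (if w j = b then d j else 0)) *
          (x a b / (r a * s b)) := by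
      intro i j
      by_cases h1 : u i = a
      · by_cases h2 : w j = b
        · subst h1 h2
          simp only [and_self, if_true, C]
          ring
        · simp [h2]
      · simp [h1]
    simp_rw [this, ← Finset.sum_mul, ← Finset.mul_sum, hds, ← Finset.sum_mul, hcr]
    by_cases h1 : r a = 0
    · simp [hr0 a b h1]
    · by_cases h2 : s b = 0
      · simp [hs0 a b h2]
      · field_simp
  refine ⟨ι × κ, inferInstance, fun p => glue A (σ p.1) (τ p.2), C,
    fun p => (hσ p.1).glue (hτ p.2) (hu p.1) (hw p.2), fun p => ?_, fun a b => ?_⟩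
  · exact mul_nonneg (mul_nonneg (div_nonneg (hc _) (hrn _)) (div_nonneg (hd _) (hsn _)))
      (hx.nonneg _ _)
  rw [Fintype.sum_prod_type]
  by_cases ha : a ∈ A <;> by_cases hb : b ∈ A
  · have := hcx (some ⟨a, ha⟩) (some ⟨b, hb⟩)
    rw [contract_shrink_some_some x hx.diag] at this
    rw [← this]
    refine Finset.sum_congr rfl fun i _ => ?_
    simp_rw [fun j => glue_inside_inside (hσ i) (hu i) (hw j) ⟨a, ha⟩ ⟨b, hb⟩]
    split_ifs
    · exact hC₁ i
    · simp
  · rw [← hC₃ ⟨a, ha⟩ ⟨b, Finset.mem_compl.mpr hb⟩]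
    simp_rw [fun i j => glue_inside_outside (hσ i) (hu i) (hw j) ⟨a, ha⟩
      ⟨b, Finset.mem_compl.mpr hb⟩]
  · rw [hx.symm, ← hC₃ ⟨b, hb⟩ ⟨a, Finset.mem_compl.mpr ha⟩]
    simp_rw [fun i j => glue_outside_inside (hτ j) (hu i) (hw j)
      ⟨a, Finset.mem_compl.mpr ha⟩ ⟨b, hb⟩]
  · have := hdx (some ⟨a, Finset.mem_compl.mpr ha⟩) (some ⟨b, Finset.mem_compl.mpr hb⟩)
    rw [contract_shrink_some_some x hx.diag] at this
    rw [← this, Finset.sum_comm]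
    refine Finset.sum_congr rfl fun j _ => ?_
    simp_rw [fun i => glue_outside_outside (hτ j) (hu i) (hw j)
      ⟨a, Finset.mem_compl.mpr ha⟩ ⟨b, Finset.mem_compl.mpr hb⟩]
    split_ifs
    · exact hC₂ j
    · simp

/-- The incidence vector of a perfect matching. -/
def indicator {V : Type} [DecidableEq V] (σ : V → V) (a b : V) : ℝ := if σ a = b then 1 else 0

theorem IsMix.add_indicator {V : Type} [DecidableEq V] {x : V → V → ℝ} (hx : IsMix x)
    {σ : V → V} (hσ : IsPairing σ) {s t : ℝ} (hs : 0 ≤ s) (ht : 0 ≤ t) :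
    IsMix fun a b => s * indicator σ a b + t * x a b := by
  obtain ⟨ι, _, τ, c, hτ, hc, hcx⟩ := hx
  refine ⟨Option ι, inferInstance, fun o => o.elim σ τ, fun o => o.elim s fun i => t * c i,
    ?_, ?_, fun a b => ?_⟩
  · rintro (_ | i)
    exacts [hσ, hτ i]
  · rintro (_ | i)
    exacts [hs, mul_nonneg ht (hc i)]
  · simp [Fintype.sum_option, ← hcx, indicator, Finset.mul_sum]
    rfl

end Gluing

/-! ### Edmonds' theorem -/

section Edmonds

variable {V : Type} [Fintype V] [DecidableEq V]

theorem cut_sub_div (x : V → V → ℝ) (σ : V → V) (ε : ℝ) (A : Finset V) :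
    cut (fun a b => (x a b - ε * indicator σ a b) / (1 - ε)) A =
      (cut x A - ε * cut (indicator σ) A) / (1 - ε) := by
  simp only [cut, ← Finset.sum_div, Finset.sum_sub_distrib, ← Finset.mul_sum]

theorem IsPairing.indicator_comm {V : Type} [DecidableEq V] {σ : V → V} (hσ : IsPairing σ)
    (a b : V) : indicator σ a b = indicator σ b a := by
  simp only [indicator, hσ.eq_comm_apply a b]

theorem IsPairing.indicator_self {V : Type} [DecidableEq V] {σ : V → V} (hσ : IsPairing σ) (a : V) :
    indicator σ a a = 0 := by
  simp [indicator, (hσ a).1]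

theorem sum_indicator (σ : V → V) (a : V) : ∑ b, indicator σ a b = 1 := by
  simp [indicator]

/-- Empty and singleton sets have cut 0 and 1 under a pairing. Applied to a set and its complement,
this ensures that both contractions lose vertices. -/
theorem IsPairing.card_of_one_lt_cut {σ : V → V} (hσ : IsPairing σ) {A : Finset V}
    (hA : 1 < cut (indicator σ) A) : 1 < A.card := by
  by_contra! h
  rcases Nat.le_one_iff_eq_zero_or_eq_one.mp h with h | h
  · rw [Finset.card_eq_zero] at h
    subst h
    simp [cut] at hA
    linarith
  · obtain ⟨a, rfl⟩ := Finset.card_eq_one.mp h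
    rw [cut_singleton hσ.indicator_self, sum_indicator] at hA
    exact lt_irrefl _ hA

/-- **Edmonds' perfect matching polytope theorem.** -/
theorem IsFracPM.isMix {x : V → V → ℝ} (hx : IsFracPM x) : IsMix x := by
  classical
  -- Lexicographic induction: on the number of vertices, then on the size of the support.
  suffices H : ∀ n m : ℕ, ∀ (V : Type) [Fintype V] [DecidableEq V] (x : V → V → ℝ),
      Fintype.card V = n → (Finset.univ.filter fun p : V × V => x p.1 p.2 ≠ 0).card = m →
      IsFracPM x → IsMix x from H _ _ V x rfl rfl hx
  clear hx x
  intro n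
  induction n using Nat.strong_induction_on with
  | _ n ihn =>
  intro m
  induction m using Nat.strong_induction_on with
  | _ m ihm =>
  intro V _ _ x hn hm hx
  have tight : ∀ (y : V → V → ℝ) (A : Finset V), IsFracPM y → Odd A.card → cut y A = 1 →
      1 < A.card → 1 < Aᶜ.card → IsMix y := by
    intro y A hy hA hcut h1 h2
    have hcard := Finset.card_compl_add_card A
    have hA' : Odd Aᶜ.card := by
      have := hy.even_card
      rw [← hcard] at this
      grind
    refine isMix_of_shrink hy A (ihn _ ?_ _ _ _ rfl rfl (hy.shrink hA hcut))
      (ihn _ ?_ _ _ _ rfl rfl (hy.shrink hA' (by rw [cut_compl hy.symm, hcut])))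
    · rw [Fintype.card_option, Fintype.card_coe]
      omega
    · rw [Fintype.card_option, Fintype.card_coe]
      omega
  rcases isEmpty_or_nonempty V with hV | hV
  · exact ⟨Empty, inferInstance, fun i => i.elim, fun i => i.elim, fun i => i.elim,
      fun i => i.elim, fun a => hV.elim a⟩
  obtain ⟨σ, hσ, hpos⟩ := hx.exists_pairing
  -- The constraints that may fail when `σ` is subtracted and the rest rescaled. `g` gives the
  -- multiple of `σ` at which each becomes tight, so its minimum `ε` is the largest admissible one.
  let I := V ⊕ {A : Finset V // Odd A.card ∧ 1 < cut (indicator σ) A}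
  let g : I → ℝ := Sum.elim (fun v => x v (σ v))
    (fun A => (cut x A.1 - 1) / (cut (indicator σ) A.1 - 1))
  obtain ⟨i, -, hi⟩ := Finset.exists_min_image (Finset.univ : Finset I) g
    ⟨Sum.inl hV.some, Finset.mem_univ _⟩
  set ε := g i with hε
  have hεx : ∀ v, ε ≤ x v (σ v) := fun v => hi (Sum.inl v) (Finset.mem_univ _)
  have hεA : ∀ A : Finset V, Odd A.card → 1 < cut (indicator σ) A →
      ε * (cut (indicator σ) A - 1) ≤ cut x A - 1 := by
    intro A h1 h2
    have := hi (Sum.inr ⟨A, h1, h2⟩) (Finset.mem_univ _)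
    exact (le_div_iff₀ (by linarith)).mp this
  have hε0 : 0 ≤ ε := by
    rcases i with v | A
    · exact (hpos v).le
    · exact div_nonneg (by linarith [hx.odd A.1 A.2.1]) (by linarith [A.2.2])
  have hxle : ∀ a b, x a b ≤ 1 := by
    intro a b
    rw [← hx.row a]
    exact Finset.single_le_sum (fun b _ => hx.nonneg a b) (Finset.mem_univ b)
  have hε1 : ε ≤ 1 := (hεx hV.some).trans (hxle _ _)
  -- If `ε = 1`, then `x` is the incidence vector of `σ`; otherwise the remainder can be rescaled by
  -- `1 - ε`.
  rcases hε1.eq_or_lt with h1 | h1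
  · refine ⟨Unit, inferInstance, fun _ => σ, fun _ => 1, fun _ => hσ, fun _ => zero_le_one,
      fun a b => ?_⟩
    have ha : x a (σ a) = 1 := le_antisymm (hxle _ _) (h1 ▸ hεx a)
    simp only [Finset.univ_unique, Finset.sum_singleton]
    split_ifs with h
    · rw [← h, ha]
    · have h2 := hx.row a
      rw [← Finset.add_sum_erase _ _ (Finset.mem_univ (σ a)), ha] at h2
      have h3 : ∑ b ∈ Finset.univ.erase (σ a), x a b = 0 := by linarith
      rw [Finset.sum_eq_zero_iff_of_nonneg fun b _ => hx.nonneg a b] at h3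
      exact (h3 b (by simp [Ne.symm h])).symm
  have hd : 0 < 1 - ε := by linarith
  set y : V → V → ℝ := fun a b => (x a b - ε * indicator σ a b) / (1 - ε) with hy
  have hxy : x = fun a b => ε * indicator σ a b + (1 - ε) * y a b := by
    funext a b
    simp only [hy]
    field_simp
    ring
  have hyF : IsFracPM y := by
    refine ⟨fun a b => div_nonneg ?_ hd.le, fun a b => ?_, fun a => ?_, fun a => ?_,
      fun A hA => ?_⟩
    · unfold indicator
      split_ifs with h
      · subst h
        linarith [hεx a]
      · simpa using hx.nonneg a b
    · simp only [hy, hx.symm a b, hσ.indicator_comm a b]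
    · simp [hy, hx.diag, hσ.indicator_self]
    · simp only [hy, ← Finset.sum_div, Finset.sum_sub_distrib, ← Finset.mul_sum, sum_indicator,
        hx.row]
      field_simp
    · rw [hy, cut_sub_div, le_div_iff₀ hd]
      by_cases h : 1 < cut (indicator σ) A
      · linarith [hεA A hA h]
      · nlinarith [hx.odd A hA]
  rw [hxy]
  refine IsMix.add_indicator ?_ hσ hε0 hd.le
  -- The minimum is attained either at an edge of `σ`, which leaves the support, or at an odd cut,
  -- which becomes tight.
  rcases i with v | ⟨A, hA, hcA⟩
  · refine ihm _ ?_ V y hn rfl hyF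
    rw [← hm]
    refine Finset.card_lt_card ⟨fun p hp => ?_, fun hsub => ?_⟩
    · simp only [Finset.mem_filter, Finset.mem_univ, true_and] at hp ⊢
      intro h0
      apply hp
      have h2 : σ p.1 ≠ p.2 := by
        intro h
        have := hpos p.1
        rw [h, h0] at this
        exact lt_irrefl _ this
      simp [hy, h0, indicator, h2]
    · have h2 : (v, σ v) ∈ Finset.univ.filter fun p : V × V => x p.1 p.2 ≠ 0 := by
        simp [(hpos v).ne']
      have h3 := hsub h2
      simp only [Finset.mem_filter, Finset.mem_univ, true_and] at h3
      apply h3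
      have : ε = x v (σ v) := rfl
      simp [hy, indicator, this]
  · have hgA : ε = (cut x A - 1) / (cut (indicator σ) A - 1) := rfl
    have hne : cut (indicator σ) A - 1 ≠ 0 := by linarith
    refine tight y A hyF hA ?_ (hσ.card_of_one_lt_cut hcA)
      (hσ.card_of_one_lt_cut (by rwa [cut_compl hσ.indicator_comm]))
    rw [hy, cut_sub_div, div_eq_one_iff_eq hd.ne']
    have : ε * (cut (indicator σ) A - 1) = cut x A - 1 := by
      rw [hgA]
      field_simp
    linarith

end Edmonds

/-! ### Weights of matchings and bounds for `η` -/

section Weights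

variable {V : Type} [Fintype V] [DecidableEq V] {G : SimpleGraph V}

/-- Ordered adjacent pairs are darts, and each edge carries two of them. -/
theorem sum_sum_sym2 (F : Sym2 V → ℝ) (hF : ∀ e ∉ G.edgeSet, F e = 0) :
    ∑ a, ∑ b, F s(a, b) = 2 * ∑ᶠ e ∈ G.edgeSet, F e := by
  classical
  rw [← Fintype.sum_prod_type' (f := fun a b => F s(a, b))]
  have h1 : ∑ p : V × V, F s(p.1, p.2) = ∑ d : G.Dart, F d.edge := by
    rw [← Finset.sum_filter_of_ne (p := fun p : V × V => G.Adj p.1 p.2)]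
    · symm
      refine Finset.sum_bij (fun d _ => d.toProd) (fun d _ => by simp [d.adj])
        (fun d _ d' _ h => SimpleGraph.Dart.ext _ _ h) (fun p hp => ?_) (fun d _ => rfl)
      exact ⟨⟨p, (Finset.mem_filter.mp hp).2⟩, Finset.mem_univ _, rfl⟩
    · intro p _ hp
      by_contra h
      exact hp (hF _ h)
  rw [h1, finsum_mem_eq_finite_toFinset_sum _ (Set.toFinite _), Finset.mul_sum,
    ← Finset.sum_fiberwise_of_maps_to (t := (Set.toFinite G.edgeSet).toFinset)
      (g := SimpleGraph.Dart.edge) (by simp [SimpleGraph.Dart.edge_mem])]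
  refine Finset.sum_congr rfl fun e he => ?_
  have he' : e ∈ G.edgeSet := by simpa using he
  rw [Finset.sum_congr rfl (g := fun _ => F e) (fun d hd => by rw [(Finset.mem_filter.mp hd).2]),
    Finset.sum_const, G.dart_edge_fiber_card e he', nsmul_eq_mul]
  norm_num

open Classical in
/-- The weight of the pair `a, b`, which is zero if the pair is not an edge. -/
def pairWeight (w : G.edgeSet → ℝ≥0) (a b : V) : ℝ :=
  if h : G.Adj a b then (w ⟨s(a, b), h⟩ : ℝ) else 0

theorem pairWeight_nonneg {V : Type} {G : SimpleGraph V} (w : G.edgeSet → ℝ≥0) (a b : V) :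
    0 ≤ pairWeight w a b := by
  unfold pairWeight
  split_ifs
  exacts [NNReal.coe_nonneg _, le_rfl]

open Classical in
theorem two_mul_weight (w : G.edgeSet → ℝ≥0) (M : G.Subgraph) :
    2 * weight G w M = ∑ a, ∑ b, if M.Adj a b then pairWeight w a b else 0 := by
  let F : Sym2 V → ℝ := fun e => if h : e ∈ M.edgeSet then w ⟨e, M.edgeSet_subset h⟩ else 0
  have hF : ∀ a b, (if M.Adj a b then pairWeight w a b else 0) = F s(a, b) := by
    intro a b
    simp only [F, SimpleGraph.Subgraph.mem_edgeSet]
    split_ifs with h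
    · simp [pairWeight, M.adj_sub h]
    · rfl
  simp_rw [hF]
  rw [sum_sum_sym2 (G := G) F (fun e he => dif_neg fun h => he (M.edgeSet_subset h))]
  congr 1
  unfold weight
  have h2 : ∀ e : G.edgeSet, (e : Sym2 V) ∈ M.edgeSet → (w e : ℝ) = F e := by
    intro e he
    simp [F, he]
  rw [finsum_mem_eq_finite_toFinset_sum _ (Set.toFinite _),
    finsum_mem_eq_finite_toFinset_sum _ (Set.toFinite _)]
  rw [← Finset.sum_filter_of_ne (p := fun e => e ∈ M.edgeSet)
    (s := (Set.toFinite G.edgeSet).toFinset)]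
  · refine Finset.sum_bij (fun e _ => e.1) ?_ ?_ ?_ ?_
    · intro e he
      simpa using he
    · intro e _ e' _ h
      exact Subtype.ext h
    · intro e he
      simp only [Set.Finite.mem_toFinset, Finset.mem_filter] at he
      exact ⟨⟨e, he.1⟩, by simpa using he.2, rfl⟩
    · intro e he
      exact h2 e (by simpa using he)
  · intro e _ h
    by_contra hne
    exact h (dif_neg hne)

/-- The perfect matching given by a pairing. -/
def IsPairing.toSubgraph {V : Type} {G : SimpleGraph V} {σ : V → V} (hσ : IsPairing σ)
    (hG : ∀ v, G.Adj v (σ v)) : G.Subgraph where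
  verts := Set.univ
  Adj a b := σ a = b
  adj_sub := by
    rintro a b rfl
    exact hG a
  edge_vert _ := Set.mem_univ _
  symm := ⟨fun a b h => (hσ.eq_comm_apply a b).mp h⟩

theorem IsPairing.isPerfectMatching_toSubgraph {V : Type} {G : SimpleGraph V} {σ : V → V}
    (hσ : IsPairing σ) (hG : ∀ v, G.Adj v (σ v)) : (hσ.toSubgraph hG).IsPerfectMatching := by
  rw [SimpleGraph.Subgraph.isPerfectMatching_iff]
  exact fun v => ⟨σ v, rfl, fun b hb => Eq.symm hb⟩

theorem exists_pairing_of_isPerfectMatching {V : Type} {G : SimpleGraph V} {P : G.Subgraph}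
    (hP : P.IsPerfectMatching) : ∃ σ : V → V, IsPairing σ ∧ ∀ a b, P.Adj a b ↔ σ a = b := by
  rw [SimpleGraph.Subgraph.isPerfectMatching_iff] at hP
  choose σ hσ hu using hP
  refine ⟨σ, fun v => ⟨fun h => (hσ v).adj_sub.ne h.symm, (hu _ _ (hσ v).symm).symm⟩,
    fun a b => ⟨fun h => (hu a b h).symm, ?_⟩⟩
  rintro rfl
  exact hσ a

theorem two_mul_weight_of_pairing (w : G.edgeSet → ℝ≥0) {P : G.Subgraph} {σ : V → V}
    (h : ∀ a b, P.Adj a b ↔ σ a = b) : 2 * weight G w P = ∑ a, pairWeight w a (σ a) := by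
  classical
  rw [two_mul_weight]
  refine Finset.sum_congr rfl fun a _ => ?_
  simp_rw [h]
  simp

open Classical in
theorem sum_adj_of_cubic {V : Type} [Fintype V] {G : SimpleGraph V}
    (hG : ∀ v, (G.neighborSet v).ncard = 3) (a : V) (r : ℝ) :
    ∑ b, (if G.Adj a b then r else 0) = 3 * r := by
  rw [← Finset.sum_filter, Finset.sum_const, nsmul_eq_mul]
  congr 1
  have := hG a
  rw [Set.ncard_eq_toFinset_card'] at this
  have h2 : (Finset.univ.filter fun b => G.Adj a b) = (G.neighborSet a).toFinset := by
    ext b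
    simp
  rw [h2, this]
  norm_num

theorem IsConnectedCubic.edgeSet_nonempty {V : Type} [Finite V] {G : SimpleGraph V}
    (hG : IsConnectedCubic G) : G.edgeSet.Nonempty := by
  obtain ⟨v⟩ := hG.1.nonempty
  have h : (G.neighborSet v).Nonempty := by
    rw [← Set.ncard_pos, hG.2]
    norm_num
  obtain ⟨u, hu⟩ := h
  exact ⟨s(v, u), hu⟩

-- The average weight of the perfect matchings in the combination is a third of the weight of all
-- edges, and no matching weighs more than all edges together.
open Classical in
theorem third_le_eta (hG : IsConnectedCubic G)
    (hmix : IsMix fun a b => if G.Adj a b then (1 / 3 : ℝ) else 0) : 1 / 3 ≤ eta G := by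
  obtain ⟨w, hw, hr⟩ := (eta_isLeast G hG.edgeSet_nonempty).1
  rw [hr, le_div_iff₀ (maxMatchingWeight_pos G w hw)]
  obtain ⟨v₀⟩ := hG.1.nonempty
  obtain ⟨ι, _, σ, c, hσ, hc, hx⟩ := hmix
  beta_reduce at hx
  -- Each pairing matches `v₀` exactly once, so the coefficients sum to the row of `v₀`, which is
  -- three times 1/3.
  have hc1 : ∑ i, c i = 1 := by
    have h1 : ∑ b, ∑ i, (if σ i v₀ = b then c i else 0) = 1 := by
      simp_rw [hx]
      rw [sum_adj_of_cubic hG.2]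
      norm_num
    rw [Finset.sum_comm] at h1
    simpa using h1
  -- Only pairings with positive coefficient must lie in `G`: on non-edges the nonnegative terms sum
  -- to zero.
  have hadj : ∀ i, 0 < c i → ∀ v, G.Adj v (σ i v) := by
    intro i hi v
    by_contra h
    have h1 := hx v (σ i v)
    rw [if_neg h, Finset.sum_eq_zero_iff_of_nonneg] at h1
    · have := h1 i (Finset.mem_univ i)
      simp only [if_true] at this
      exact hi.ne' this
    · intro j _
      split_ifs
      exacts [hc j, le_rfl]
  obtain ⟨M, hM, hMw⟩ := (maxMatchingWeight_isGreatest G w).1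
  have hMle : 2 * maxMatchingWeight G w ≤ ∑ a, ∑ b, pairWeight w a b := by
    rw [← hMw, two_mul_weight]
    refine Finset.sum_le_sum fun a _ => Finset.sum_le_sum fun b _ => ?_
    split_ifs
    exacts [le_rfl, pairWeight_nonneg w a b]
  have hP : ∀ i, 0 < c i → ∑ a, pairWeight w a (σ i a) ≤ 2 * maxPerfectMatchingWeight G w := by
    intro i hi
    have hp := (hσ i).isPerfectMatching_toSubgraph (hadj i hi)
    rw [← two_mul_weight_of_pairing w (P := (hσ i).toSubgraph (hadj i hi)) fun _ _ => Iff.rfl]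
    have := (maxPerfectMatchingWeight_isGreatest G w ⟨_, hp⟩).2 ⟨_, hp, rfl⟩
    linarith
  have hsum : ∑ i, c i * ∑ a, pairWeight w a (σ i a) = 1 / 3 * ∑ a, ∑ b, pairWeight w a b := by
    calc ∑ i, c i * ∑ a, pairWeight w a (σ i a)
        = ∑ i, ∑ a, ∑ b, (if σ i a = b then c i else 0) * pairWeight w a b := by
          refine Finset.sum_congr rfl fun i _ => ?_
          rw [Finset.mul_sum]
          refine Finset.sum_congr rfl fun a _ => ?_
          simp
      _ = ∑ a, ∑ b, ∑ i, (if σ i a = b then c i else 0) * pairWeight w a b := by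
          rw [Finset.sum_comm]
          exact Finset.sum_congr rfl fun a _ => Finset.sum_comm
      _ = ∑ a, ∑ b, 1 / 3 * pairWeight w a b := by
          refine Finset.sum_congr rfl fun a _ => Finset.sum_congr rfl fun b _ => ?_
          rw [← Finset.sum_mul]
          have := hx a b
          rw [this]
          split_ifs with h
          · rfl
          · simp [pairWeight, h]
      _ = _ := by simp_rw [Finset.mul_sum]
  have hle : ∑ i, c i * ∑ a, pairWeight w a (σ i a) ≤
      ∑ i, c i * (2 * maxPerfectMatchingWeight G w) := by
    refine Finset.sum_le_sum fun i _ => ?_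
    rcases (hc i).eq_or_lt with h | h
    · simp [← h]
    · exact mul_le_mul_of_nonneg_left (hP i h) h.le
  rw [hsum, ← Finset.sum_mul, hc1] at hle
  linarith

/-- A matching `M` in which every perfect matching has at most a `q`-fraction of its edges
bounds `η` by `q`. Fractions are counted by the number of vertices. -/
theorem eta_le_of_matching {M : G.Subgraph} (hM : M.IsMatching) (hne : M.edgeSet.Nonempty)
    {q : ℝ} (hq : 0 ≤ q)
    (h : ∀ σ : V → V, IsPairing σ → (∀ v, G.Adj v (σ v)) →
      ({v | M.Adj v (σ v)}.ncard : ℝ) ≤ q * M.verts.ncard) : eta G ≤ q := by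
  classical
  -- Under the incidence vector of `M`, twice a weight is a number of vertices, so the counts in `h`
  -- compare the weights directly.
  let w : G.edgeSet → ℝ≥0 := fun e => if (e : Sym2 V) ∈ M.edgeSet then 1 else 0
  have hpw : ∀ a b, pairWeight w a b = if M.Adj a b then 1 else 0 := by
    intro a b
    unfold pairWeight
    by_cases h1 : M.Adj a b
    · simp [h1, M.adj_sub h1, w]
    · simp [h1, w]
  have hw : w ≠ 0 := by
    obtain ⟨e, he⟩ := hne
    intro h0
    have := congrFun h0 ⟨e, M.edgeSet_subset he⟩
    simp [w, he] at this
  have hMw : 2 * weight G w M = M.verts.ncard := by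
    rw [two_mul_weight, Set.ncard_eq_toFinset_card']
    simp_rw [hpw]
    have : ∀ a, (∑ b, if M.Adj a b then (if M.Adj a b then (1 : ℝ) else 0) else 0) =
        if a ∈ M.verts then 1 else 0 := by
      intro a
      split_ifs with ha
      · obtain ⟨b, hb, hu⟩ := hM ha
        rw [Finset.sum_eq_single b]
        · simp [hb]
        · intro c _ hc
          have : ¬ M.Adj a c := fun h => hc (hu c h)
          simp [this]
        · simp
      · refine Finset.sum_eq_zero fun b _ => ?_
        have : ¬ M.Adj a b := fun h => ha h.fst_mem
        simp [this]
    simp_rw [this]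
    simp
  have hmm : weight G w M ≤ maxMatchingWeight G w :=
    (maxMatchingWeight_isGreatest G w).2 ⟨M, hM, rfl⟩
  have hpos := maxMatchingWeight_pos G w hw
  have hP : maxPerfectMatchingWeight G w ≤ q * maxMatchingWeight G w := by
    refine Real.sSup_le ?_ (by positivity)
    rintro _ ⟨P, hP, rfl⟩
    obtain ⟨σ, hσ, hPσ⟩ := exists_pairing_of_isPerfectMatching hP
    have h1 := two_mul_weight_of_pairing w hPσ
    simp_rw [hpw] at h1
    have h2 := h σ hσ fun v => P.adj_sub ((hPσ v _).mpr rfl)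
    have h3 : (∑ a, if M.Adj a (σ a) then (1 : ℝ) else 0) = {v | M.Adj v (σ v)}.ncard := by
      rw [Set.ncard_eq_toFinset_card']
      simp
    nlinarith
  refine ((eta_isLeast G (hne.mono M.edgeSet_subset)).2 ⟨w, hw, rfl⟩).trans ?_
  rwa [div_le_iff₀ hpos]

end Weights

/-- A matching, given as a symmetric relation, that covers three fifths of the vertices and leaves
an independent set uncovered. -/
structure IsSparseMaximal {V : Type} (G : SimpleGraph V) (R : V → V → Prop) : Prop where
  symm : ∀ a b, R a b → R b a
  adj : ∀ a b, R a b → G.Adj a b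
  unique : ∀ a b c, R a b → R a c → b = c
  indep : ∀ a b, G.Adj a b → (∃ c, R a c) ∨ ∃ c, R b c
  card : 5 * {a | ∃ b, R a b}.ncard = 3 * Nat.card V

/-- With `n` vertices, the `2n/5` uncovered ones have distinct covered partners in any perfect
matching. At most `3n/5 - 2n/5 = n/5` covered vertices keep their partner, a third of those covered.
-/
theorem IsSparseMaximal.eta_le {V : Type} [Fintype V] [Nonempty V] {G : SimpleGraph V}
    {R : V → V → Prop} (hR : IsSparseMaximal G R) : eta G ≤ 1 / 3 := by
  classical
  let M : G.Subgraph :=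
    { verts := {a | ∃ b, R a b}
      Adj := R
      adj_sub := hR.adj _ _
      edge_vert := fun h => ⟨_, h⟩
      symm := ⟨hR.symm⟩ }
  have hM : M.IsMatching := fun a ⟨b, hb⟩ => ⟨b, hb, fun c hc => hR.unique a c b hc hb⟩
  set S : Finset V := Finset.univ.filter fun a => ∃ b, R a b with hS
  have hScard : {a | ∃ b, R a b}.ncard = S.card := by
    rw [Set.ncard_eq_toFinset_card']
    simp [hS]
  have hcard := hR.card
  rw [hScard, Nat.card_eq_fintype_card] at hcard
  refine eta_le_of_matching hM ?_ (by norm_num) fun σ hσ hadj => ?_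
  · have h0 : 0 < Fintype.card V := Fintype.card_pos
    have : 0 < S.card := by omega
    obtain ⟨a, ha⟩ := Finset.card_pos.mp this
    obtain ⟨b, hb⟩ := (Finset.mem_filter.mp ha).2
    exact ⟨s(a, b), hb⟩
  · have h1 : (Sᶜ.image σ) ⊆ S := by
      intro b hb
      obtain ⟨a, ha, rfl⟩ := Finset.mem_image.mp hb
      simp only [hS, Finset.compl_filter, Finset.mem_filter, Finset.mem_univ, true_and] at ha ⊢
      exact (hR.indep _ _ (hadj a)).resolve_left ha
    have h2 : (Sᶜ.image σ).card = Sᶜ.card :=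
      Finset.card_image_of_injective _ fun a b h => by
        rw [← (hσ a).2, h, (hσ b).2]
    have h3 : (Finset.univ.filter fun v => R v (σ v)) ⊆ S \ Sᶜ.image σ := by
      intro v hv
      have hv' : R v (σ v) := (Finset.mem_filter.mp hv).2
      simp only [Finset.mem_sdiff, Finset.mem_image, not_exists, not_and]
      refine ⟨by simp only [hS, Finset.mem_filter, Finset.mem_univ, true_and]; exact ⟨_, hv'⟩, ?_⟩
      rintro a ha rfl
      rw [(hσ a).2] at hv'
      simp only [hS, Finset.compl_filter, Finset.mem_filter, Finset.mem_univ, true_and] at ha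
      exact ha ⟨_, hR.symm _ _ hv'⟩
    have h4 := Finset.card_le_card h3
    rw [Finset.card_sdiff_of_subset h1, h2] at h4
    have h5 := Finset.card_compl_add_card S
    have h6 : {v | M.Adj v (σ v)}.ncard = (Finset.univ.filter fun v => R v (σ v)).card := by
      rw [Set.ncard_eq_toFinset_card']
      simp [M]
    have h7 : M.verts.ncard = S.card := hScard
    rw [h6, h7]
    have h8 : 3 * (Finset.univ.filter fun v => R v (σ v)).card ≤ S.card := by omega
    have h9 : (3 : ℝ) * (Finset.univ.filter fun v => R v (σ v)).card ≤ S.card := by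
      exact_mod_cast h8
    linarith

/-! ### Bridgeless cubic graphs and edge colorings -/

section Cubic

variable {V : Type} {G : SimpleGraph V}

/-- Every edge cut that contains an edge contains a second one. -/
def HasNoCutEdge (G : SimpleGraph V) : Prop :=
  ∀ (S : Set V) (a b : V), a ∈ S → b ∉ S → G.Adj a b →
    ∃ c d, c ∈ S ∧ d ∉ S ∧ G.Adj c d ∧ ¬ (c = a ∧ d = b)

/-- A walk avoiding `ab` leaves `S` along another edge. Conversely, take for `S` the vertices
reachable from `a` without using `ab`. -/
theorem isBridgeless_iff_hasNoCutEdge : IsBridgeless G ↔ HasNoCutEdge G := by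
  constructor
  · intro h S a b ha hb hab
    have h1 := h s(a, b) hab
    rw [SimpleGraph.isBridge_iff, not_not] at h1
    obtain ⟨p⟩ := h1
    obtain ⟨d, -, hd1, hd2⟩ := p.exists_boundary_dart S ha hb
    have hd := d.adj
    rw [SimpleGraph.deleteEdges_adj] at hd
    refine ⟨d.fst, d.snd, hd1, hd2, hd.1, ?_⟩
    rintro ⟨h1, h2⟩
    apply hd.2
    rw [h1, h2]
    rfl
  · intro h e he hb
    induction e with
    | h a b =>
      rw [SimpleGraph.isBridge_iff] at hb
      obtain ⟨c, d, hc, hd, hcd, hne⟩ := h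
        {v | (G.deleteEdges {s(a, b)}).Reachable a v} a b (.refl _) hb he
      apply hd
      refine SimpleGraph.Reachable.trans hc (SimpleGraph.Adj.reachable ?_)
      rw [SimpleGraph.deleteEdges_adj]
      refine ⟨hcd, fun h1 => ?_⟩
      rcases Sym2.eq_iff.mp (show s(c, d) = s(a, b) from h1) with h2 | ⟨rfl, rfl⟩
      · exact hne h2
      · exact hb hc

theorem even_sum_of_symm [DecidableEq V] {f : V → V → ℕ} (hf : ∀ a b, f a b = f b a)
    (h0 : ∀ a, f a a = 0) (A : Finset V) : Even (∑ a ∈ A, ∑ b ∈ A, f a b) := by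
  induction A using Finset.induction_on with
  | empty => simp
  | insert v A hv ih =>
    have h1 : ∑ a ∈ insert v A, ∑ b ∈ insert v A, f a b =
        2 * (∑ b ∈ A, f v b) + ∑ a ∈ A, ∑ b ∈ A, f a b := by
      simp only [Finset.sum_insert hv, h0, Finset.sum_add_distrib]
      simp_rw [fun a => hf a v]
      ring
    rw [h1]
    exact (even_two_mul _).add ih

variable [Fintype V] [DecidableEq V]

open Classical in
/-- A third of each edge of a bridgeless cubic graph satisfies Edmonds' constraints. -/
theorem isFracPM_third (hG : ∀ v, (G.neighborSet v).ncard = 3) (hb : HasNoCutEdge G) :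
    IsFracPM fun a b => if G.Adj a b then (1 / 3 : ℝ) else 0 where
  nonneg a b := by positivity
  symm a b := by simp [G.adj_comm]
  diag a := by simp
  row a := by
    rw [sum_adj_of_cubic hG]
    norm_num
  odd A hA := by
    let f : V → V → ℕ := fun a b => if G.Adj a b then 1 else 0
    have hcut : cut (fun a b => if G.Adj a b then (1 / 3 : ℝ) else 0) A =
        1 / 3 * ((∑ a ∈ A, ∑ b ∈ Aᶜ, f a b : ℕ) : ℝ) := by
      unfold cut
      push_cast
      rw [Finset.mul_sum]
      simp_rw [Finset.mul_sum]
      simp [f]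
    have hdeg : ∑ a ∈ A, ∑ b ∈ A, f a b + ∑ a ∈ A, ∑ b ∈ Aᶜ, f a b = 3 * A.card := by
      rw [← Finset.sum_add_distrib]
      simp_rw [Finset.sum_add_sum_compl]
      rw [mul_comm, ← smul_eq_mul, ← Finset.sum_const]
      refine Finset.sum_congr rfl fun a _ => ?_
      have := sum_adj_of_cubic hG a 1
      rw [mul_one] at this
      exact_mod_cast this
    have heven := even_sum_of_symm (f := f) (fun a b => by simp [f, G.adj_comm])
      (fun a => by simp [f]) A
    -- The degree sum over `A` is `3 |A|`, an odd number, and the edges inside `A` contribute an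
    -- even part.
    have hNodd : Odd (∑ a ∈ A, ∑ b ∈ Aᶜ, f a b) := by grind
    have hNcard : ∑ a ∈ A, ∑ b ∈ Aᶜ, f a b =
        ((A ×ˢ Aᶜ).filter fun p => G.Adj p.1 p.2).card := by
      rw [← Finset.sum_product', Finset.card_filter]
    have h1 : 1 < ∑ a ∈ A, ∑ b ∈ Aᶜ, f a b := by
      rw [hNcard]
      obtain ⟨p, hp⟩ := Finset.card_pos.mp (hNcard ▸ hNodd.pos)
      simp only [Finset.mem_filter, Finset.mem_product, Finset.mem_compl] at hp
      obtain ⟨c, d, hc, hd, hcd, hne⟩ := hb A p.1 p.2 hp.1.1 hp.1.2 hp.2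
      refine Finset.one_lt_card.mpr ⟨p, ?_, (c, d), ?_, ?_⟩
      · simpa using hp
      · simpa using ⟨⟨hc, hd⟩, hcd⟩
      · rintro rfl
        exact hne ⟨rfl, rfl⟩
    have h3 : 3 ≤ ∑ a ∈ A, ∑ b ∈ Aᶜ, f a b := by
      obtain ⟨k, hk⟩ := hNodd
      omega
    rw [hcut]
    have h3' : (3 : ℝ) ≤ ((∑ a ∈ A, ∑ b ∈ Aᶜ, f a b : ℕ) : ℝ) := by exact_mod_cast h3
    linarith

theorem third_le_eta_of_hasNoCutEdge (hG : IsConnectedCubic G) (hb : HasNoCutEdge G) :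
    1 / 3 ≤ eta G :=
  third_le_eta hG (isFracPM_third hG.2 hb).isMix

theorem third_le_eta_of_isHamiltonian (hG : IsConnectedCubic G) (hh : G.IsHamiltonian) :
    1 / 3 ≤ eta G :=
  third_le_eta_of_hasNoCutEdge hG
    (isBridgeless_iff_hasNoCutEdge.mp fun _ _ he => he.not_isHamiltonian hh)

/-- A proper colouring of the edges by three colours. -/
structure IsEdgeColoring {V : Type} (G : SimpleGraph V) (c : V → V → Fin 3) : Prop where
  symm : ∀ a b, G.Adj a b → c a b = c b a
  proper : ∀ a b d, G.Adj a b → G.Adj a d → c a b = c a d → b = d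

/-- Three edges with distinct colors at a vertex use up all three colors, so every color class is a
perfect matching. -/
theorem IsEdgeColoring.existsUnique {V : Type} {G : SimpleGraph V} {c : V → V → Fin 3}
    (hc : IsEdgeColoring G c) (hG : ∀ v, (G.neighborSet v).ncard = 3) (a : V) (i : Fin 3) :
    ∃! b, G.Adj a b ∧ c a b = i := by
  have hinj : Set.InjOn (c a) (G.neighborSet a) := fun b hb d hd h => hc.proper a b d hb hd h
  have himg : c a '' G.neighborSet a = Set.univ := by
    refine Set.eq_of_subset_of_ncard_le (Set.subset_univ _) ?_
    rw [hinj.ncard_image, hG]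
    simp
  have hi : i ∈ c a '' G.neighborSet a := himg ▸ Set.mem_univ i
  obtain ⟨b, hb, rfl⟩ := hi
  exact ⟨b, ⟨hb, rfl⟩, fun d hd => hc.proper a d b hd.1 hb hd.2⟩

theorem isTaitColorable_iff {V : Type} {G : SimpleGraph V} (hG : IsConnectedCubic G) :
    IsTaitColorable G ↔ ∃ c, IsEdgeColoring G c := by
  classical
  constructor
  · rintro ⟨-, P, hP, hu⟩
    choose σ hσ hPσ using fun i => exists_pairing_of_isPerfectMatching (hP i)
    choose! C hC hCu using hu
    refine ⟨fun a b => C s(a, b), fun a b _ => by rw [Sym2.eq_swap], fun a b d hab had h => ?_⟩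
    have h1 := hC s(a, b) hab
    have h2 := hC s(a, d) had
    simp only at h1 h2 h
    rw [h] at h1
    rw [SimpleGraph.Subgraph.mem_edgeSet, hPσ] at h1 h2
    rw [← h1, h2]
  · rintro ⟨c, hc⟩
    choose σ hσ hu using fun i a => (hc.existsUnique hG.2 a i).exists
    have huniq : ∀ i a b, G.Adj a b → c a b = i → σ i a = b := fun i a b hab h =>
      hc.proper a _ b (hσ i a) hab ((hu i a).trans h.symm)
    have hp : ∀ i, IsPairing (σ i) := fun i a =>
      ⟨(hσ i a).ne', huniq i _ a (hσ i a).symm ((hc.symm _ _ (hσ i a).symm).trans (hu i a))⟩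
    refine ⟨hG, fun i => (hp i).toSubgraph (hσ i),
      fun i => (hp i).isPerfectMatching_toSubgraph (hσ i), fun e he => ?_⟩
    induction e with
    | h a b =>
      refine ⟨c a b, huniq _ a b he rfl, fun i hi => ?_⟩
      have : σ i a = b := hi
      rw [← this, hu]

-- The color classes with coefficients 1/3 are the required combination, so Edmonds' theorem is not
-- needed.
open Classical in
theorem IsTaitColorable.third_le_eta (hG : IsTaitColorable G) : 1 / 3 ≤ eta G := by
  have hcub := hG.1
  obtain ⟨-, P, hP, hu⟩ := hG
  choose σ hσ hPσ using fun i => exists_pairing_of_isPerfectMatching (hP i)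
  refine CostOfPerfection.third_le_eta hcub
    ⟨Fin 3, inferInstance, σ, fun _ => 1 / 3, hσ, fun _ => by norm_num, fun a b => ?_⟩
  simp_rw [← hPσ]
  split_ifs with h
  · obtain ⟨i, hi, hiu⟩ := hu s(a, b) h
    rw [Finset.sum_eq_single i]
    · exact if_pos hi
    · intro j _ hj
      exact if_neg fun h' => hj (hiu j h')
    · simp
  · exact Finset.sum_eq_zero fun i _ => if_neg fun h' => h h'.adj_sub

end Cubic

/-! ### Invariance under isomorphism -/

section Transport

variable {V W : Type} {G : SimpleGraph V} {H : SimpleGraph W}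

theorem IsConnectedCubic.of_iso (hH : IsConnectedCubic H) (e : G ≃g H) : IsConnectedCubic G := by
  refine ⟨e.connected_iff.mpr hH.1, fun v => ?_⟩
  rw [← hH.2 (e v)]
  exact Nat.card_congr (e.mapNeighborSet v)

theorem HasNoCutEdge.of_iso (hH : HasNoCutEdge H) (e : G ≃g H) : HasNoCutEdge G := by
  intro S a b ha hb hab
  obtain ⟨c, d, hc, hd, hcd, hne⟩ := hH (e.symm ⁻¹' S) (e a) (e b) (by simpa using ha)
    (by simpa using hb) (e.map_adj_iff.mpr hab)
  refine ⟨e.symm c, e.symm d, hc, hd, e.symm.map_adj_iff.mpr hcd, ?_⟩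
  rintro ⟨rfl, rfl⟩
  exact hne (by simp)

theorem IsSparseMaximal.of_iso {R : W → W → Prop} (hR : IsSparseMaximal H R) (e : G ≃g H) :
    IsSparseMaximal G fun a b => R (e a) (e b) where
  symm _ _ := hR.symm _ _
  adj _ _ h := e.map_adj_iff.mp (hR.adj _ _ h)
  unique _ _ _ h h' := e.injective (hR.unique _ _ _ h h')
  indep a b hab := by
    rcases hR.indep _ _ (e.map_adj_iff.mpr hab) with ⟨c, hc⟩ | ⟨c, hc⟩
    · exact Or.inl ⟨e.symm c, by simpa using hc⟩
    · exact Or.inr ⟨e.symm c, by simpa using hc⟩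
  card := by
    rw [Nat.card_congr e.toEquiv, ← hR.card]
    congr 1
    rw [← Set.ncard_image_of_injective _ e.injective]
    congr 1
    ext b
    constructor
    · rintro ⟨a, ⟨c, hc⟩, rfl⟩
      exact ⟨_, hc⟩
    · rintro ⟨c, hc⟩
      exact ⟨e.symm b, ⟨e.symm c, by simpa using hc⟩, by simp⟩

theorem IsEdgeColoring.of_iso {c : W → W → Fin 3} (hc : IsEdgeColoring H c) (e : G ≃g H) :
    IsEdgeColoring G fun a b => c (e a) (e b) where
  symm _ _ h := hc.symm _ _ (e.map_adj_iff.mpr h)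
  proper _ _ _ hab had heq :=
    e.injective (hc.proper _ _ _ (e.map_adj_iff.mpr hab) (e.map_adj_iff.mpr had) heq)

/-- Bridgelessness, by showing that a vertex set that can only be left along `ab` is not left. -/
theorem hasNoCutEdge_of_forall (h : ∀ (S : Set V) (a b : V), G.Adj a b →
    (∀ c d, G.Adj c d → s(c, d) ≠ s(a, b) → (c ∈ S ↔ d ∈ S)) → (a ∈ S ↔ b ∈ S)) :
    HasNoCutEdge G := by
  intro S a b ha hb hab
  by_contra! hno
  refine hb ((h S a b hab fun c d hcd hne => ?_).mp ha)
  by_contra hx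
  rcases not_iff.mp hx with h'
  by_cases hc : c ∈ S
  · have hd : d ∉ S := fun hd => hx ⟨fun _ => hd, fun _ => hc⟩
    obtain ⟨rfl, rfl⟩ := hno c d hc hd hcd
    exact hne rfl
  · have hd : d ∈ S := h'.mp hc
    obtain ⟨rfl, rfl⟩ := hno d c hd hc hcd.symm
    exact hne Sym2.eq_swap

end Transport

/-! ### Generalized Petersen graphs -/

section GeneralizedPetersen

variable {n k : ℕ}

theorem genPetersen_adj_inl_inl (hn : 3 ≤ n) (i j : ZMod n) :
    (genPetersen n k).Adj (.inl i) (.inl j) ↔ j = i + 1 ∨ i = j + 1 := by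
  have : Fact (1 < n) := ⟨by omega⟩
  simp only [genPetersen, SimpleGraph.fromRel_adj]
  simp
  rintro (rfl | rfl) <;> simp

theorem genPetersen_adj_inl_inr (i j : ZMod n) :
    (genPetersen n k).Adj (.inl i) (.inr j) ↔ i = j := by
  simp [genPetersen, SimpleGraph.fromRel_adj, eq_comm]

theorem genPetersen_adj_inr_inl (i j : ZMod n) :
    (genPetersen n k).Adj (.inr i) (.inl j) ↔ i = j := by
  simp [genPetersen, SimpleGraph.fromRel_adj]

theorem natCast_ne_zero_of_lt {m : ℕ} (hm : 0 < m) (hmn : m < n) : (m : ZMod n) ≠ 0 := by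
  rw [Ne, ZMod.natCast_eq_zero_iff]
  exact Nat.not_dvd_of_pos_of_lt hm hmn

theorem genPetersen_adj_inr_inr (hk : 1 ≤ k) (hkn : k < n) (i j : ZMod n) :
    (genPetersen n k).Adj (.inr i) (.inr j) ↔ j = i + k ∨ i = j + k := by
  have := natCast_ne_zero_of_lt hk hkn
  simp only [genPetersen, SimpleGraph.fromRel_adj]
  simp
  rintro (rfl | rfl) <;> simpa

theorem genPetersen_isConnectedCubic (hn : 3 ≤ n) (hk : 1 ≤ k) (hkn : k ≤ (n - 1) / 2) :
    IsConnectedCubic (genPetersen n k) := by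
  have hkn' : k < n := by omega
  have : NeZero n := ⟨by omega⟩
  -- `2 ≠ 0` separates the two outer neighbors of a vertex, and `2k ≠ 0`, which holds as `2k < n`,
  -- the two inner ones.
  have h2 : ((2 : ℕ) : ZMod n) ≠ 0 := natCast_ne_zero_of_lt (by norm_num) (by omega)
  have h2k : ((2 * k : ℕ) : ZMod n) ≠ 0 := natCast_ne_zero_of_lt (by omega) (by omega)
  push_cast at h2 h2k
  constructor
  · have hr : ∀ m : ℕ, (genPetersen n k).Reachable (.inl 0) (.inl (m : ZMod n)) := by
      intro m
      induction m with
      | zero => simp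
      | succ m ih =>
        refine ih.trans (SimpleGraph.Adj.reachable ?_)
        rw [genPetersen_adj_inl_inl hn]
        simp
    have hr' : ∀ v, (genPetersen n k).Reachable (.inl 0) v := by
      rintro (i | i)
      · simpa using hr i.val
      · refine SimpleGraph.Reachable.trans (by simpa using hr i.val) (SimpleGraph.Adj.reachable
          ((genPetersen_adj_inl_inr i i).mpr rfl))
    exact { preconnected := fun u v => (hr' u).symm.trans (hr' v), nonempty := ⟨.inl 0⟩ }
  · rintro (i | i)
    · rw [Set.ncard_eq_three]
      refine ⟨.inl (i + 1), .inl (i - 1), .inr i, ?_, by simp, by simp, ?_⟩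
      · intro h
        have h' := Sum.inl.inj h
        exact h2 (by linear_combination h')
      · ext (j | j)
        · simp [genPetersen_adj_inl_inl hn, eq_sub_iff_add_eq, eq_comm]
        · simp [genPetersen_adj_inl_inr, eq_comm]
    · rw [Set.ncard_eq_three]
      refine ⟨.inr (i + k), .inr (i - k), .inl i, ?_, by simp, by simp, ?_⟩
      · intro h
        have h' := Sum.inr.inj h
        exact h2k (by linear_combination h')
      · ext (j | j)
        · simp [genPetersen_adj_inr_inl, eq_comm]
        · simp [genPetersen_adj_inr_inr hk hkn', eq_sub_iff_add_eq, eq_comm]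

/-- Every edge has a detour: the rest of the outer cycle for an outer edge; the outer cycle, another
spoke and an inner edge for a spoke; two spokes and the outer cycle for an inner edge. -/
theorem genPetersen_hasNoCutEdge (hn : 3 ≤ n) (hk : 1 ≤ k) (hkn : k ≤ (n - 1) / 2) :
    HasNoCutEdge (genPetersen n k) := by
  have hkn' : k < n := by omega
  have : NeZero n := ⟨by omega⟩
  have h2 : ((2 : ℕ) : ZMod n) ≠ 0 := natCast_ne_zero_of_lt (by norm_num) (by omega)
  have hk0 : (k : ZMod n) ≠ 0 := natCast_ne_zero_of_lt hk hkn'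
  push_cast at h2
  have outer : ∀ S : Set (ZMod n ⊕ ZMod n), (∀ j, Sum.inl j ∈ S ↔ Sum.inl (j + 1) ∈ S) →
      ∀ i j : ZMod n, Sum.inl i ∈ S ↔ Sum.inl j ∈ S := by
    intro S hS
    have h : ∀ m : ℕ, Sum.inl (0 : ZMod n) ∈ S ↔ Sum.inl (m : ZMod n) ∈ S := by
      intro m
      induction m with
      | zero => simp
      | succ m ih =>
        rw [ih, hS]
        simp
    intro i j
    have hi := h i.val
    have hj := h j.val
    rw [ZMod.natCast_zmod_val] at hi hj
    rw [← hi, hj]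
  apply hasNoCutEdge_of_forall
  have aoo : ∀ j, (genPetersen n k).Adj (.inl j) (.inl (j + 1)) := fun j =>
    (genPetersen_adj_inl_inl hn _ _).mpr (.inl rfl)
  have asp : ∀ j, (genPetersen n k).Adj (.inl j) (.inr j) := fun j =>
    (genPetersen_adj_inl_inr _ _).mpr rfl
  have ain : ∀ j : ZMod n, (genPetersen n k).Adj (.inr j) (.inr (j + k)) := fun j =>
    (genPetersen_adj_inr_inr hk hkn' _ _).mpr (.inl rfl)
  have hout : ∀ (S : Set (ZMod n ⊕ ZMod n)) (i : ZMod n),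
      (∀ c d, (genPetersen n k).Adj c d → s(c, d) ≠ s(.inl i, .inl (i + 1)) → (c ∈ S ↔ d ∈ S)) →
      (.inl i ∈ S ↔ .inl (i + 1) ∈ S) := by
    intro S i h
    -- Go around the outer cycle from `i + 1`; after `n - 1` steps `i` is reached without the edge
    -- in question.
    have hm : ∀ m : ℕ, m < n → (Sum.inl (i + 1) ∈ S ↔ Sum.inl (i + 1 + m) ∈ S) := by
      intro m
      induction m with
      | zero => simp
      | succ m ih =>
        intro hmn
        rw [ih (by omega), h _ _ (aoo _)]
        · push_cast
          rw [add_assoc (i + 1)]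
        · intro he
          rcases Sym2.eq_iff.mp he with ⟨h1, -⟩ | ⟨h1, h3⟩
          · have h1' := Sum.inl.inj h1
            have : ((m + 1 : ℕ) : ZMod n) = 0 := by
              push_cast
              linear_combination h1'
            exact natCast_ne_zero_of_lt (by omega) hmn this
          · have h1' := Sum.inl.inj h1
            have h3' := Sum.inl.inj h3
            exact h2 (by linear_combination h3' - h1')
    have := hm (n - 1) (by omega)
    rw [this]
    have hz : i + 1 + ((n - 1 : ℕ) : ZMod n) = i := by
      rw [Nat.cast_sub (by omega)]
      simp
    rw [hz]
  have hsp : ∀ (S : Set (ZMod n ⊕ ZMod n)) (i : ZMod n),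
      (∀ c d, (genPetersen n k).Adj c d → s(c, d) ≠ s(.inl i, .inr i) → (c ∈ S ↔ d ∈ S)) →
      (.inl i ∈ S ↔ .inr i ∈ S) := by
    intro S i h
    have ho := outer S fun j => h _ _ (aoo j) (by simp)
    rw [ho i (i + k), h _ _ (asp _) (by simp [hk0]), h _ _ (ain i) (by simp)]
  have hin : ∀ (S : Set (ZMod n ⊕ ZMod n)) (i : ZMod n),
      (∀ c d, (genPetersen n k).Adj c d → s(c, d) ≠ s(.inr i, .inr (i + k)) → (c ∈ S ↔ d ∈ S)) →
      (.inr i ∈ S ↔ .inr (i + k) ∈ S) := by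
    intro S i h
    have ho := outer S fun j => h _ _ (aoo j) (by simp)
    rw [← h _ _ (asp _) (by simp), ← h _ _ (asp _) (by simp), ho]
  rintro S (a | a) (b | b) hab h
  · rcases (genPetersen_adj_inl_inl hn _ _).mp hab with rfl | rfl
    · exact hout S a h
    · rw [Sym2.eq_swap] at h
      exact (hout S b h).symm
  · obtain rfl := (genPetersen_adj_inl_inr _ _).mp hab
    exact hsp S a h
  · obtain rfl := (genPetersen_adj_inr_inl _ _).mp hab
    rw [Sym2.eq_swap] at h
    exact (hsp S a h).symm
  · rcases (genPetersen_adj_inr_inr hk hkn' _ _).mp hab with rfl | rfl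
    · exact hin S a h
    · rw [Sym2.eq_swap] at h
      exact (hin S b h).symm

end GeneralizedPetersen

/-! ### The Petersen graph -/

section Petersen

/-- Adjacency in the Petersen graph by cases. -/
def PetersenAdj : ZMod 5 ⊕ ZMod 5 → ZMod 5 ⊕ ZMod 5 → Prop
  | .inl i, .inl j => j = i + 1 ∨ i = j + 1
  | .inl i, .inr j => i = j
  | .inr i, .inl j => i = j
  | .inr i, .inr j => j = i + 2 ∨ i = j + 2

instance : DecidableRel PetersenAdj
  | .inl i, .inl j => inferInstanceAs (Decidable (j = i + 1 ∨ i = j + 1))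
  | .inl i, .inr j => inferInstanceAs (Decidable (i = j))
  | .inr i, .inl j => inferInstanceAs (Decidable (i = j))
  | .inr i, .inr j => inferInstanceAs (Decidable (j = i + 2 ∨ i = j + 2))

theorem petersen_adj (a b : ZMod 5 ⊕ ZMod 5) : petersen.Adj a b ↔ PetersenAdj a b := by
  unfold petersen
  rcases a with i | i <;> rcases b with j | j
  · exact genPetersen_adj_inl_inl (by norm_num) i j
  · exact genPetersen_adj_inl_inr i j
  · exact genPetersen_adj_inr_inl i j
  · exact genPetersen_adj_inr_inr (by norm_num) (by norm_num) i j

theorem petersen_isSparseMaximal :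
    IsSparseMaximal petersen fun a b => s(a, b) ∈ petersenMatching where
  symm a b h := by rwa [Sym2.eq_swap]
  adj a b h := by
    rw [petersen_adj]
    simp only [petersenMatching, Set.mem_insert_iff, Set.mem_singleton_iff] at h
    revert a b
    decide
  unique a b c h h' := by
    simp only [petersenMatching, Set.mem_insert_iff, Set.mem_singleton_iff] at h h'
    revert a b c
    decide
  indep a b h := by
    rw [petersen_adj] at h
    simp only [petersenMatching, Set.mem_insert_iff, Set.mem_singleton_iff]
    revert a b
    decide
  card := by
    have : {a | ∃ b, s(a, b) ∈ petersenMatching} =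
        ((Finset.univ.filter fun a : ZMod 5 ⊕ ZMod 5 => ∃ b, s(a, b) = s(.inl 1, .inr 1) ∨
          s(a, b) = s(.inl 3, .inl 4) ∨ s(a, b) = s(.inr 0, .inr 2) : Finset _) : Set _) := by
      ext a
      simp [petersenMatching]
    rw [this, Set.ncard_coe_finset, Nat.card_eq_fintype_card]
    decide

set_option synthInstance.maxSize 2000 in
set_option synthInstance.maxHeartbeats 200000 in
set_option maxRecDepth 10000 in
theorem petersen_not_colorable (c : ZMod 5 ⊕ ZMod 5 → ZMod 5 ⊕ ZMod 5 → Fin 3) :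
    ¬ IsEdgeColoring petersen c := by
  intro hc
  -- `oᵢ`, `sᵢ`, `tᵢ` are the colors of the edges `uᵢuᵢ₊₁`, `uᵢvᵢ`, `vᵢvᵢ₊₂`. Each constraint stands
  -- right after its last color, so that the exhaustive search is pruned early.
  have key : ∀ o₀ o₁ : Fin 3, o₀ ≠ o₁ → ∀ o₂, o₁ ≠ o₂ → ∀ o₃, o₂ ≠ o₃ → ∀ o₄, o₃ ≠ o₄ → o₄ ≠ o₀ →
      ∀ s₀, s₀ ≠ o₄ → s₀ ≠ o₀ → ∀ s₁, s₁ ≠ o₀ → s₁ ≠ o₁ → ∀ s₂, s₂ ≠ o₁ → s₂ ≠ o₂ →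
      ∀ s₃, s₃ ≠ o₂ → s₃ ≠ o₃ → ∀ s₄, s₄ ≠ o₃ → s₄ ≠ o₄ →
      ∀ t₀, s₀ ≠ t₀ → s₂ ≠ t₀ → ∀ t₂, s₂ ≠ t₂ → s₄ ≠ t₂ → t₀ ≠ t₂ →
      ∀ t₄, s₄ ≠ t₄ → s₁ ≠ t₄ → t₂ ≠ t₄ → ∀ t₁, s₁ ≠ t₁ → s₃ ≠ t₁ → t₄ ≠ t₁ →
      ∀ t₃, s₃ ≠ t₃ → s₀ ≠ t₃ → t₁ ≠ t₃ → t₃ ≠ t₀ → False := by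
    decide
  have ne : ∀ a b d, petersen.Adj a b → petersen.Adj a d → b ≠ d → c a b ≠ c a d :=
    fun a b d h h' hne hcd => hne (hc.proper a b d h h' hcd)
  have ne' : ∀ a b d, petersen.Adj b a → petersen.Adj a d → b ≠ d → c b a ≠ c a d := by
    intro a b d h h'
    rw [hc.symm b a h]
    exact ne a b d h.symm h'
  have ne'' : ∀ a b d, petersen.Adj b a → petersen.Adj d a → b ≠ d → c b a ≠ c d a := by
    intro a b d h h'
    rw [hc.symm d a h']
    exact ne' a b d h h'.symm
  simp only [petersen_adj] at ne ne' ne''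
  refine key (c (.inl 0) (.inl 1)) (c (.inl 1) (.inl 2)) ?_ (c (.inl 2) (.inl 3)) ?_
    (c (.inl 3) (.inl 4)) ?_ (c (.inl 4) (.inl 0)) ?_ ?_
    (c (.inl 0) (.inr 0)) ?_ ?_ (c (.inl 1) (.inr 1)) ?_ ?_ (c (.inl 2) (.inr 2)) ?_ ?_
    (c (.inl 3) (.inr 3)) ?_ ?_ (c (.inl 4) (.inr 4)) ?_ ?_
    (c (.inr 0) (.inr 2)) ?_ ?_ (c (.inr 2) (.inr 4)) ?_ ?_ ?_
    (c (.inr 4) (.inr 1)) ?_ ?_ ?_ (c (.inr 1) (.inr 3)) ?_ ?_ ?_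
    (c (.inr 3) (.inr 0)) ?_ ?_ ?_ ?_
  all_goals first
    | exact ne _ _ _ (by decide) (by decide) (by decide)
    | exact ne' _ _ _ (by decide) (by decide) (by decide)
    | exact (ne' _ _ _ (by decide) (by decide) (by decide)).symm
    | exact ne'' _ _ _ (by decide) (by decide) (by decide)

end Petersen

/-! ### Joining two graphs along edges -/

section EdgeJoin

variable {V W : Type} {H₁ : SimpleGraph V} {H₂ : SimpleGraph W} {u v : V} {x y : W}

theorem edgeJoin_adj_inl_inl (a b : V) : (edgeJoin H₁ H₂ u v x y).Adj (.inl a) (.inl b) ↔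
    H₁.Adj a b ∧ s(a, b) ≠ s(u, v) := by
  simp [edgeJoin, SimpleGraph.edge_adj]

theorem edgeJoin_adj_inr_inr (a b : W) : (edgeJoin H₁ H₂ u v x y).Adj (.inr a) (.inr b) ↔
    H₂.Adj a b ∧ s(a, b) ≠ s(x, y) := by
  simp [edgeJoin, SimpleGraph.edge_adj]

theorem edgeJoin_adj_inl_inr (a : V) (b : W) : (edgeJoin H₁ H₂ u v x y).Adj (.inl a) (.inr b) ↔
    a = u ∧ b = y ∨ a = v ∧ b = x := by
  simp [edgeJoin, SimpleGraph.edge_adj]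

theorem edgeJoin_adj_inr_inl (a : W) (b : V) : (edgeJoin H₁ H₂ u v x y).Adj (.inr a) (.inl b) ↔
    b = u ∧ a = y ∨ b = v ∧ a = x := by
  rw [SimpleGraph.adj_comm, edgeJoin_adj_inl_inr]

/-- Joining is symmetric. -/
def edgeJoinSwap (H₁ : SimpleGraph V) (H₂ : SimpleGraph W) (u v : V) (x y : W) :
    edgeJoin H₁ H₂ u v x y ≃g edgeJoin H₂ H₁ x y u v where
  toEquiv := Equiv.sumComm V W
  map_rel_iff' := by
    rintro (a | a) (b | b) <;>
      simp only [Equiv.sumComm_apply, Sum.swap_inl, Sum.swap_inr, edgeJoin_adj_inl_inl,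
        edgeJoin_adj_inr_inr, edgeJoin_adj_inl_inr, edgeJoin_adj_inr_inl] <;>
      tauto

/-- The neighbors are in bijection with the old ones: `u` exchanges `v` for `y`, and `v` exchanges
`u` for `x`. -/
theorem edgeJoin_ncard_inl [Finite V] (huv : H₁.Adj u v) (a : V) :
    ((edgeJoin H₁ H₂ u v x y).neighborSet (.inl a)).ncard = (H₁.neighborSet a).ncard := by
  classical
  have hne := huv.ne
  let f : V → V ⊕ W := fun b =>
    if a = u ∧ b = v then .inr y else if a = v ∧ b = u then .inr x else .inl b
  have hf : Function.Injective f := by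
    intro b d h
    simp only [f] at h
    grind
  rw [← Set.ncard_image_of_injective _ hf]
  congr 1
  ext (b | b)
  · simp only [SimpleGraph.mem_neighborSet, edgeJoin_adj_inl_inl, Set.mem_image, f]
    constructor
    · rintro ⟨h1, h2⟩
      refine ⟨b, h1, ?_⟩
      rw [if_neg, if_neg]
      · rintro ⟨rfl, rfl⟩
        exact h2 Sym2.eq_swap
      · rintro ⟨rfl, rfl⟩
        exact h2 rfl
    · rintro ⟨d, h1, h2⟩
      split_ifs at h2 with h3 h4
      obtain rfl := Sum.inl.inj h2
      refine ⟨h1, fun h => ?_⟩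
      rcases Sym2.eq_iff.mp h with h | h
      exacts [h3 h, h4 h]
  · simp only [SimpleGraph.mem_neighborSet, edgeJoin_adj_inl_inr, Set.mem_image, f]
    constructor
    · rintro (⟨rfl, rfl⟩ | ⟨rfl, rfl⟩)
      · exact ⟨v, huv, by simp⟩
      · exact ⟨u, huv.symm, by simp [hne.symm]⟩
    · rintro ⟨d, h1, h2⟩
      split_ifs at h2 with h3 h4
      · exact Or.inl ⟨h3.1, (Sum.inr.inj h2).symm⟩
      · exact Or.inr ⟨h4.1, (Sum.inr.inj h2).symm⟩

theorem edgeJoin_ncard [Finite V] [Finite W] (h₁ : ∀ a, (H₁.neighborSet a).ncard = 3)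
    (h₂ : ∀ a, (H₂.neighborSet a).ncard = 3) (huv : H₁.Adj u v) (hxy : H₂.Adj x y) (p : V ⊕ W) :
    ((edgeJoin H₁ H₂ u v x y).neighborSet p).ncard = 3 := by
  rcases p with a | a
  · rw [edgeJoin_ncard_inl huv, h₁]
  · rw [← h₂ a, ← edgeJoin_ncard_inl (H₂ := H₁) (x := u) (y := v) hxy a]
    exact Nat.card_congr ((edgeJoinSwap H₁ H₂ u v x y).mapNeighborSet (.inr a))

theorem mem_iff_of_connected {V : Type} {G : SimpleGraph V} (hG : G.Connected) {S : Set V}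
    (hS : ∀ c d, G.Adj c d → (c ∈ S ↔ d ∈ S)) (a b : V) : a ∈ S ↔ b ∈ S := by
  obtain ⟨p⟩ := hG.preconnected a b
  induction p with
  | nil => rfl
  | cons h _ ih => exact (hS _ _ h).trans ih

/-- Connectivity in terms of vertex sets that no edge leaves, the form in which it combines with
`HasNoCutEdge`. -/
theorem connected_of_forall_mem_iff {V : Type} {G : SimpleGraph V} [hV : Nonempty V]
    (h : ∀ S : Set V, (∀ c d, G.Adj c d → (c ∈ S ↔ d ∈ S)) → ∀ a b, a ∈ S ↔ b ∈ S) :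
    G.Connected := by
  refine { preconnected := fun a b => ?_, nonempty := hV }
  exact (h {w | G.Reachable a w}
    (fun c d hcd => ⟨fun hc => hc.trans hcd.reachable, fun hd => hd.trans hcd.symm.reachable⟩)
    a b).mp (.refl _)

/-- A bridgeless graph stays connected if an edge is deleted. -/
theorem HasNoCutEdge.mem_iff {V : Type} {G : SimpleGraph V} (hb : HasNoCutEdge G) {u v : V}
    (huv : G.Adj u v) {S : Set V}
    (hS : ∀ c d, G.Adj c d → s(c, d) ≠ s(u, v) → (c ∈ S ↔ d ∈ S)) : u ∈ S ↔ v ∈ S := by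
  have aux : ∀ u v, G.Adj u v → (∀ c d, G.Adj c d → s(c, d) ≠ s(u, v) → (c ∈ S ↔ d ∈ S)) →
      u ∈ S → v ∈ S := by
    intro u v huv hS hu
    by_contra hv
    obtain ⟨c, d, hc, hd, hcd, hne⟩ := hb S u v hu hv huv
    refine hd ((hS c d hcd fun h => ?_).mp hc)
    rcases Sym2.eq_iff.mp h with h | ⟨rfl, rfl⟩
    exacts [hne h, hv hc]
  exact ⟨aux u v huv hS, aux v u huv.symm (by rwa [Sym2.eq_swap])⟩

theorem HasNoCutEdge.forall_mem_iff {V : Type} {G : SimpleGraph V} (hb : HasNoCutEdge G)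
    (hG : G.Connected) {u v : V} (huv : G.Adj u v) {S : Set V}
    (hS : ∀ c d, G.Adj c d → s(c, d) ≠ s(u, v) → (c ∈ S ↔ d ∈ S)) (a b : V) : a ∈ S ↔ b ∈ S := by
  refine mem_iff_of_connected hG (fun c d hcd => ?_) a b
  by_cases h : s(c, d) = s(u, v)
  · rcases Sym2.eq_iff.mp h with ⟨rfl, rfl⟩ | ⟨rfl, rfl⟩
    · exact hb.mem_iff huv hS
    · exact (hb.mem_iff huv hS).symm
  · exact hS c d hcd h

theorem edgeJoin_connected (h₁ : H₁.Connected) (b₁ : HasNoCutEdge H₁) (huv : H₁.Adj u v)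
    (h₂ : H₂.Connected) (b₂ : HasNoCutEdge H₂) (hxy : H₂.Adj x y) :
    (edgeJoin H₁ H₂ u v x y).Connected := by
  have : Nonempty (V ⊕ W) := ⟨.inl u⟩
  refine connected_of_forall_mem_iff fun S hS => ?_
  have hV := b₁.forall_mem_iff h₁ huv (S := Sum.inl ⁻¹' S) fun c d hcd hne =>
    hS _ _ ((edgeJoin_adj_inl_inl c d).mpr ⟨hcd, hne⟩)
  have hW := b₂.forall_mem_iff h₂ hxy (S := Sum.inr ⁻¹' S) fun c d hcd hne =>
    hS _ _ ((edgeJoin_adj_inr_inr c d).mpr ⟨hcd, hne⟩)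
  have hVW : ∀ a b, Sum.inl a ∈ S ↔ Sum.inr b ∈ S := fun a b =>
    (hV a u).trans ((hS _ _ ((edgeJoin_adj_inl_inr u y).mpr (.inl ⟨rfl, rfl⟩))).trans (hW y b))
  rintro (a | a) (b | b)
  exacts [hV a b, hVW a b, (hVW b a).symm, hW a b]

/-- Inside `H₁` the deleted edge `uv` is replaced by the detour over `uy`, the connected graph `H₂ -
xy` and `xv`, and likewise in `H₂`. Each of the two new edges is bypassed by the other. -/
theorem edgeJoin_hasNoCutEdge (h₁ : H₁.Connected) (b₁ : HasNoCutEdge H₁) (huv : H₁.Adj u v)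
    (h₂ : H₂.Connected) (b₂ : HasNoCutEdge H₂) (hxy : H₂.Adj x y) :
    HasNoCutEdge (edgeJoin H₁ H₂ u v x y) := by
  have inside : ∀ {V W : Type} {H₁ : SimpleGraph V} {H₂ : SimpleGraph W} {u v : V} {x y : W}
      (_ : HasNoCutEdge H₁) (_ : H₂.Connected) (_ : HasNoCutEdge H₂) (_ : H₂.Adj x y)
      (S : Set (V ⊕ W)) (a b : V), (edgeJoin H₁ H₂ u v x y).Adj (.inl a) (.inl b) →
      (∀ c d, (edgeJoin H₁ H₂ u v x y).Adj c d → s(c, d) ≠ s(.inl a, .inl b) →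
        (c ∈ S ↔ d ∈ S)) → (.inl a ∈ S ↔ .inl b ∈ S) := by
    intro V W H₁ H₂ u v x y b₁ h₂ b₂ hxy S a b hab hS
    have hW := b₂.forall_mem_iff h₂ hxy (S := Sum.inr ⁻¹' S) fun c d hcd hne =>
      hS _ _ ((edgeJoin_adj_inr_inr c d).mpr ⟨hcd, hne⟩) (by simp)
    have huv : Sum.inl u ∈ S ↔ Sum.inl v ∈ S :=
      (hS _ _ ((edgeJoin_adj_inl_inr u y).mpr (.inl ⟨rfl, rfl⟩)) (by simp)).trans
        ((hW y x).trans
          (hS _ _ ((edgeJoin_adj_inr_inl x v).mpr (.inr ⟨rfl, rfl⟩)) (by simp)))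
    refine b₁.mem_iff (S := Sum.inl ⁻¹' S) ((edgeJoin_adj_inl_inl a b).mp hab).1
      fun c d hcd hne => ?_
    by_cases h : s(c, d) = s(u, v)
    · rcases Sym2.eq_iff.mp h with ⟨rfl, rfl⟩ | ⟨rfl, rfl⟩
      exacts [huv, huv.symm]
    · refine hS _ _ ((edgeJoin_adj_inl_inl c d).mpr ⟨hcd, h⟩) fun h' => hne ?_
      simpa using h'
  apply hasNoCutEdge_of_forall
  have across : ∀ (S : Set (V ⊕ W)) (a : V) (b : W),
      (edgeJoin H₁ H₂ u v x y).Adj (.inl a) (.inr b) →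
      (∀ c d, (edgeJoin H₁ H₂ u v x y).Adj c d → s(c, d) ≠ s(.inl a, .inr b) →
        (c ∈ S ↔ d ∈ S)) → (.inl a ∈ S ↔ .inr b ∈ S) := by
    intro S a b hab hS
    have hV := b₁.forall_mem_iff h₁ huv (S := Sum.inl ⁻¹' S) fun c d hcd hne =>
      hS _ _ ((edgeJoin_adj_inl_inl c d).mpr ⟨hcd, hne⟩) (by simp)
    have hW := b₂.forall_mem_iff h₂ hxy (S := Sum.inr ⁻¹' S) fun c d hcd hne =>
      hS _ _ ((edgeJoin_adj_inr_inr c d).mpr ⟨hcd, hne⟩) (by simp)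
    rcases (edgeJoin_adj_inl_inr a b).mp hab with ⟨rfl, rfl⟩ | ⟨rfl, rfl⟩
    · exact (hV a v).trans ((hS _ _ ((edgeJoin_adj_inl_inr v x).mpr (.inr ⟨rfl, rfl⟩))
        (by simp [huv.ne'])).trans (hW x b))
    · exact (hV a u).trans ((hS _ _ ((edgeJoin_adj_inl_inr u y).mpr (.inl ⟨rfl, rfl⟩))
        (by simp [huv.ne])).trans (hW y b))
  rintro S (a | a) (b | b) hab hS
  · exact inside b₁ h₂ b₂ hxy S a b hab hS
  · exact across S a b hab hS
  · rw [Sym2.eq_swap] at hS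
    exact (across S b a hab.symm hS).symm
  · let e := edgeJoinSwap H₁ H₂ u v x y
    refine inside b₂ h₁ b₁ huv (Sum.swap ⁻¹' S) a b (e.map_adj_iff.mpr hab) fun c d hcd hne => ?_
    refine hS _ _ (e.symm.map_adj_iff.mpr hcd) fun h => hne ?_
    have := congrArg (Sym2.map Sum.swap) h
    simpa [e, edgeJoinSwap] using this

end EdgeJoin

/-! ### The snarks built from the Petersen graph -/

section SnarkFamily

variable {V W : Type} {H₁ : SimpleGraph V} {H₂ : SimpleGraph W} {u v : V} {x y : W}

/-- The parity lemma for the cut formed by the two new edges: they have the same colour. -/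
theorem IsEdgeColoring.edgeJoin_eq [Finite V] [Finite W] {c : V ⊕ W → V ⊕ W → Fin 3}
    (hc : IsEdgeColoring (edgeJoin H₁ H₂ u v x y) c)
    (h3 : ∀ p, ((edgeJoin H₁ H₂ u v x y).neighborSet p).ncard = 3) (huv : u ≠ v) :
    c (.inl u) (.inr y) = c (.inl v) (.inr x) := by
  classical
  have := Fintype.ofFinite V
  have := Fintype.ofFinite W
  set J := edgeJoin H₁ H₂ u v x y with hJ
  let f : Fin 3 → V → V → ℕ := fun i a b =>
    if J.Adj (.inl a) (.inl b) ∧ c (.inl a) (.inl b) = i then 1 else 0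
  have hf : ∀ i, Even (∑ a, ∑ b, f i a b) := by
    intro i
    refine even_sum_of_symm (fun a b => ?_) (fun a => by simp [f]) _
    simp only [f]
    congr 1
    rw [J.adj_comm]
    exact propext (and_congr_right fun h => by rw [hc.symm _ _ h])
  -- Each vertex of `V` has exactly one edge of color `i`. Summing over `V`, the number of new edges
  -- of color `i` has the parity of `|V|` for every `i`. With two distinct colors on the new edges,
  -- one color would occur once and a third one not at all.
  have hrow : ∀ i a, ∑ b, f i a b + ((if a = u then (if c (.inl u) (.inr y) = i then 1 else 0)
      else 0) + (if a = v then (if c (.inl v) (.inr x) = i then 1 else 0) else 0)) = 1 := by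
    intro i a
    obtain ⟨p, hp, hpu⟩ := hc.existsUnique h3 (.inl a) i
    have h1 : ∑ q, (if J.Adj (.inl a) q ∧ c (.inl a) q = i then 1 else 0) = 1 := by
      rw [Finset.sum_eq_single p]
      · exact if_pos hp
      · intro q _ hq
        exact if_neg fun h => hq (hpu q h)
      · simp
    rw [Fintype.sum_sum_type] at h1
    refine Eq.trans ?_ h1
    congr 1
    simp_rw [hJ, edgeJoin_adj_inl_inr]
    by_cases h2 : a = u
    · subst h2
      simp [huv, ite_and]
    · by_cases h4 : a = v
      · subst h4
        simp [Ne.symm huv, ite_and]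
      · simp [h2, h4]
  have hsum : ∀ i, ∑ a, ∑ b, f i a b + ((if c (.inl u) (.inr y) = i then 1 else 0) +
      (if c (.inl v) (.inr x) = i then 1 else 0)) = Fintype.card V := by
    intro i
    have := Finset.sum_congr (rfl : (Finset.univ : Finset V) = Finset.univ)
      fun a _ => hrow i a
    rw [Finset.sum_add_distrib, Finset.sum_add_distrib] at this
    simpa using this
  by_contra hne
  have third : ∀ i j : Fin 3, i ≠ j → ∃ k, i ≠ k ∧ j ≠ k := by decide
  obtain ⟨k, hk1, hk2⟩ := third _ _ hne
  have e1 := hsum k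
  have e2 := hsum (c (.inl u) (.inr y))
  have p1 := hf k
  have p2 := hf (c (.inl u) (.inr y))
  rw [if_neg hk1, if_neg hk2] at e1
  rw [if_pos rfl, if_neg (Ne.symm hne)] at e2
  grind

/-- The two new edges have the same color, which can be given to the restored edge `uv`. -/
theorem IsEdgeColoring.of_edgeJoin [Finite V] [Finite W] {c : V ⊕ W → V ⊕ W → Fin 3}
    (hc : IsEdgeColoring (edgeJoin H₁ H₂ u v x y) c)
    (h3 : ∀ p, ((edgeJoin H₁ H₂ u v x y).neighborSet p).ncard = 3) (huv : u ≠ v) :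
    ∃ d, IsEdgeColoring H₁ d := by
  classical
  have heq := hc.edgeJoin_eq h3 huv
  have hadj : ∀ a b, s(a, b) = s(u, v) → ∃ q : W, (edgeJoin H₁ H₂ u v x y).Adj (.inl a) (.inr q) ∧
      c (.inl a) (.inr q) = c (.inl u) (.inr y) := by
    intro a b h
    rcases Sym2.eq_iff.mp h with ⟨rfl, rfl⟩ | ⟨rfl, rfl⟩
    · exact ⟨y, (edgeJoin_adj_inl_inr _ _).mpr (.inl ⟨rfl, rfl⟩), rfl⟩
    · exact ⟨x, (edgeJoin_adj_inl_inr _ _).mpr (.inr ⟨rfl, rfl⟩), heq.symm⟩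
  refine ⟨fun a b => if s(a, b) = s(u, v) then c (.inl u) (.inr y) else c (.inl a) (.inl b),
    fun a b hab => ?_, fun a b d hab had h => ?_⟩
  · simp only [Sym2.eq_swap (a := b)]
    split_ifs with h
    · rfl
    · exact hc.symm _ _ ((edgeJoin_adj_inl_inl a b).mpr ⟨hab, h⟩)
  · split_ifs at h with h1 h2 h2
    · exact Sym2.congr_right.mp (h1.trans h2.symm)
    · obtain ⟨q, hq, hcq⟩ := hadj a b h1
      have := hc.proper _ _ _ hq ((edgeJoin_adj_inl_inl a d).mpr ⟨had, h2⟩) (hcq.trans h)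
      simp at this
    · obtain ⟨q, hq, hcq⟩ := hadj a d h2
      have := hc.proper _ _ _ hq ((edgeJoin_adj_inl_inl a b).mpr ⟨hab, h1⟩) (hcq.trans h.symm)
      simp at this
    · exact Sum.inl.inj (hc.proper _ _ _ ((edgeJoin_adj_inl_inl a b).mpr ⟨hab, h1⟩)
        ((edgeJoin_adj_inl_inl a d).mpr ⟨had, h2⟩) h)

theorem saturates_iff {V : Type} {M : Set (Sym2 V)} {v : V} :
    Saturates M v ↔ ∃ b, s(v, b) ∈ M := by
  constructor
  · rintro ⟨e, he, hv⟩
    obtain ⟨b, rfl⟩ := Sym2.mem_iff_exists.mp hv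
    exact ⟨b, he⟩
  · rintro ⟨b, hb⟩
    exact ⟨_, hb, Sym2.mem_mk_left v b⟩

/-- No matching edge is deleted, the new edges `uy` and `vx` have the covered ends `u` and `x`, and
the proportion 3/5 is additive. -/
theorem IsSparseMaximal.edgeJoin [Finite V] [Finite W] {M₁ : Set (Sym2 V)} {M₂ : Set (Sym2 W)}
    (h₁ : IsSparseMaximal H₁ fun a b => s(a, b) ∈ M₁)
    (h₂ : IsSparseMaximal H₂ fun a b => s(a, b) ∈ M₂) (huv : s(u, v) ∉ M₁)
    (hu : Saturates M₁ u) (hxy : s(x, y) ∉ M₂) (hx : Saturates M₂ x) :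
    IsSparseMaximal (edgeJoin H₁ H₂ u v x y)
      fun a b => s(a, b) ∈ Sym2.map Sum.inl '' M₁ ∪ Sym2.map Sum.inr '' M₂ := by
  have hll : ∀ a b : V, (s(.inl a, .inl b) : Sym2 (V ⊕ W)) ∈
      Sym2.map Sum.inl '' M₁ ∪ Sym2.map Sum.inr '' M₂ ↔ s(a, b) ∈ M₁ := by
    intro a b
    constructor
    · rintro (⟨e, he, h⟩ | ⟨e, he, h⟩)
      · rw [← Sym2.map_mk] at h
        rwa [← Sym2.map.injective Sum.inl_injective h]
      · induction e with
        | h p q => simp at h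
    · exact fun h => .inl ⟨_, h, rfl⟩
  have hrr : ∀ a b : W, (s(.inr a, .inr b) : Sym2 (V ⊕ W)) ∈
      Sym2.map Sum.inl '' M₁ ∪ Sym2.map Sum.inr '' M₂ ↔ s(a, b) ∈ M₂ := by
    intro a b
    constructor
    · rintro (⟨e, he, h⟩ | ⟨e, he, h⟩)
      · induction e with
        | h p q => simp at h
      · rw [← Sym2.map_mk] at h
        rwa [← Sym2.map.injective Sum.inr_injective h]
    · exact fun h => .inr ⟨_, h, rfl⟩
  have hlr : ∀ (a : V) (b : W), ¬ (s(.inl a, .inr b) : Sym2 (V ⊕ W)) ∈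
      Sym2.map Sum.inl '' M₁ ∪ Sym2.map Sum.inr '' M₂ := by
    rintro a b (⟨e, he, h⟩ | ⟨e, he, h⟩) <;>
    · induction e with
      | h p q => simp at h
  have hrl : ∀ (a : W) (b : V), ¬ (s(.inr a, .inl b) : Sym2 (V ⊕ W)) ∈
      Sym2.map Sum.inl '' M₁ ∪ Sym2.map Sum.inr '' M₂ := by
    intro a b
    rw [Sym2.eq_swap]
    exact hlr b a
  rw [saturates_iff] at hu hx
  have hul : ∀ a : V, (∃ b, s(a, b) ∈ M₁) → ∃ q, (s(.inl a, q) : Sym2 (V ⊕ W)) ∈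
      Sym2.map Sum.inl '' M₁ ∪ Sym2.map Sum.inr '' M₂ := fun a ⟨b, hb⟩ => ⟨_, (hll a b).mpr hb⟩
  have hur : ∀ a : W, (∃ b, s(a, b) ∈ M₂) → ∃ q, (s(.inr a, q) : Sym2 (V ⊕ W)) ∈
      Sym2.map Sum.inl '' M₁ ∪ Sym2.map Sum.inr '' M₂ := fun a ⟨b, hb⟩ => ⟨_, (hrr a b).mpr hb⟩
  refine ⟨?_, ?_, ?_, ?_, ?_⟩
  · intro a b h
    rwa [Sym2.eq_swap]
  · rintro (a | a) (b | b) h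
    · rw [hll] at h
      exact (edgeJoin_adj_inl_inl a b).mpr ⟨h₁.adj a b h, fun h' => huv (h' ▸ h)⟩
    · exact absurd h (hlr a b)
    · exact absurd h (hrl a b)
    · rw [hrr] at h
      exact (edgeJoin_adj_inr_inr a b).mpr ⟨h₂.adj a b h, fun h' => hxy (h' ▸ h)⟩
  · rintro (a | a) (b | b) (d | d) h h'
    · rw [h₁.unique a b d ((hll _ _).mp h) ((hll _ _).mp h')]
    · exact absurd h' (hlr _ _)
    · exact absurd h (hlr _ _)
    · exact absurd h (hlr _ _)
    · exact absurd h (hrl _ _)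
    · exact absurd h (hrl _ _)
    · exact absurd h' (hrl _ _)
    · rw [h₂.unique a b d ((hrr _ _).mp h) ((hrr _ _).mp h')]
  · have key : ∀ (a : V) (b : W),
        (CostOfPerfection.edgeJoin H₁ H₂ u v x y).Adj (.inl a) (.inr b) →
        (∃ d, s(a, d) ∈ M₁) ∨ ∃ d, s(b, d) ∈ M₂ := by
      intro a b hab
      rcases (edgeJoin_adj_inl_inr a b).mp hab with ⟨rfl, rfl⟩ | ⟨rfl, rfl⟩
      exacts [.inl hu, .inr hx]
    rintro (a | a) (b | b) h
    · exact (h₁.indep a b ((edgeJoin_adj_inl_inl a b).mp h).1).imp (hul a) (hul b)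
    · exact (key a b h).imp (hul a) (hur b)
    · exact ((key b a h.symm).imp (hul b) (hur a)).symm
    · exact (h₂.indep a b ((edgeJoin_adj_inr_inr a b).mp h).1).imp (hur a) (hur b)
  · have hset : {p : V ⊕ W | ∃ q, s(p, q) ∈ Sym2.map Sum.inl '' M₁ ∪ Sym2.map Sum.inr '' M₂} =
        Sum.inl '' {a | ∃ b, s(a, b) ∈ M₁} ∪ Sum.inr '' {a | ∃ b, s(a, b) ∈ M₂} := by
      ext (a | a)
      · constructor
        · rintro ⟨b | b, h⟩
          · exact .inl ⟨a, ⟨b, (hll a b).mp h⟩, rfl⟩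
          · exact absurd h (hlr a b)
        · rintro (⟨a', h, h'⟩ | ⟨a', -, h'⟩)
          · exact Sum.inl.inj h' ▸ hul a' h
          · simp at h'
      · constructor
        · rintro ⟨b | b, h⟩
          · exact absurd h (hrl a b)
          · exact .inr ⟨a, ⟨b, (hrr a b).mp h⟩, rfl⟩
        · rintro (⟨a', -, h'⟩ | ⟨a', h, h'⟩)
          · simp at h'
          · exact Sum.inr.inj h' ▸ hur a' h
    rw [hset, Set.ncard_union_eq, Set.ncard_image_of_injective _ Sum.inl_injective,
      Set.ncard_image_of_injective _ Sum.inr_injective, Nat.card_sum]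
    · have := h₁.card
      have := h₂.card
      omega
    · rw [Set.disjoint_left]
      rintro _ ⟨a, _, rfl⟩ ⟨b, _, h⟩
      simp at h

/-- What the construction of the snark family preserves. -/
structure IsSparseSnark {V : Type} (H : SimpleGraph V) (M : Set (Sym2 V)) : Prop where
  finite : Finite V
  cubic : IsConnectedCubic H
  noCutEdge : HasNoCutEdge H
  not_colorable : ∀ c, ¬ IsEdgeColoring H c
  sparse : IsSparseMaximal H fun a b => s(a, b) ∈ M

theorem Constructed.isSparseSnark {V : Type} {H : SimpleGraph V} {M : Set (Sym2 V)}
    (h : Constructed H M) : IsSparseSnark H M := by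
  induction h with
  | base =>
    exact ⟨inferInstance, genPetersen_isConnectedCubic (by norm_num) (by norm_num) (by norm_num),
      genPetersen_hasNoCutEdge (by norm_num) (by norm_num) (by norm_num),
      petersen_not_colorable, petersen_isSparseMaximal⟩
  | join _ _ huv huvM hu hv hxy hxyM hx hy ih₁ ih₂ =>
    have := ih₁.finite
    have := ih₂.finite
    have h3 := edgeJoin_ncard ih₁.cubic.2 ih₂.cubic.2 huv hxy
    refine ⟨inferInstance,
      ⟨edgeJoin_connected ih₁.cubic.1 ih₁.noCutEdge huv ih₂.cubic.1 ih₂.noCutEdge hxy, h3⟩,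
      edgeJoin_hasNoCutEdge ih₁.cubic.1 ih₁.noCutEdge huv ih₂.cubic.1 ih₂.noCutEdge hxy,
      fun c hc => ?_, ih₁.sparse.edgeJoin ih₂.sparse huvM hu hxyM hx⟩
    obtain ⟨d, hd⟩ := hc.of_edgeJoin h3 huv.ne
    exact ih₁.not_colorable d hd

/-- Some vertex is uncovered, since only 3/5 of them are covered, and all its neighbors are covered
by independence. Hence every constructed graph can be joined further. -/
theorem IsSparseSnark.exists_boundary_edge {V : Type} {H : SimpleGraph V} {M : Set (Sym2 V)}
    (h : IsSparseSnark H M) :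
    ∃ u v, H.Adj u v ∧ s(u, v) ∉ M ∧ Saturates M u ∧ ¬ Saturates M v := by
  have := h.finite
  obtain ⟨v, hv⟩ : ∃ v, ¬ Saturates M v := by
    by_contra! hall
    have h1 : {a | ∃ b, s(a, b) ∈ M} = Set.univ :=
      Set.eq_univ_of_forall fun a => saturates_iff.mp (hall a)
    have h2 := h.sparse.card
    rw [h1, Set.ncard_univ] at h2
    have := h.cubic.1.nonempty
    have : 0 < Nat.card V := Nat.card_pos
    omega
  have hne : (H.neighborSet v).Nonempty := by
    rw [← Set.ncard_pos, h.cubic.2]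
    norm_num
  obtain ⟨u, hu⟩ := hne
  have hv' := hv
  rw [saturates_iff] at hv'
  refine ⟨u, v, SimpleGraph.Adj.symm hu, fun hM => ?_, ?_, hv⟩
  · exact hv' ⟨u, by rwa [Sym2.eq_swap]⟩
  · exact saturates_iff.mpr ((h.sparse.indep v u hu).resolve_left hv')

theorem exists_constructed_card_ge (N : ℕ) :
    ∃ (V : Type) (H : SimpleGraph V) (M : Set (Sym2 V)), Constructed H M ∧ N ≤ Nat.card V := by
  induction N with
  | zero => exact ⟨_, _, _, .base, Nat.zero_le _⟩
  | succ N ih =>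
    obtain ⟨V, H, M, h, hN⟩ := ih
    have hs := h.isSparseSnark
    have := hs.finite
    obtain ⟨u, v, huv, huvM, hu, hv⟩ := hs.exists_boundary_edge
    obtain ⟨x, y, hxy, hxyM, hx, hy⟩ := Constructed.base.isSparseSnark.exists_boundary_edge
    refine ⟨_, _, _, .join h .base huv huvM hu hv hxy hxyM hx hy, ?_⟩
    rw [Nat.card_sum, Nat.card_eq_fintype_card (α := ZMod 5 ⊕ ZMod 5)]
    simp
    omega

theorem isSnark_and_eta_of_mem_petersenSnarkFamily {G : FinGraph} (hG : G ∈ petersenSnarkFamily) :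
    IsSnark G.graph ∧ eta G.graph = 1 / 3 := by
  obtain ⟨V, H, M, hc, ⟨e⟩⟩ := hG
  have h := hc.isSparseSnark
  have hcub := h.cubic.of_iso e
  have hb := h.noCutEdge.of_iso e
  have := hcub.1.nonempty
  refine ⟨⟨hcub, isBridgeless_iff_hasNoCutEdge.mpr hb, ?_⟩,
    le_antisymm (h.sparse.of_iso e).eta_le (third_le_eta_of_hasNoCutEdge hcub hb)⟩
  rw [isTaitColorable_iff hcub]
  rintro ⟨c, hc⟩
  exact h.not_colorable _ (hc.of_iso e.symm)

theorem exists_mem_petersenSnarkFamily_card_ge (N : ℕ) :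
    ∃ G ∈ petersenSnarkFamily, N ≤ Fintype.card G.V := by
  classical
  obtain ⟨V, H, M, h, hN⟩ := exists_constructed_card_ge N
  have := h.isSparseSnark.finite
  have := Fintype.ofFinite V
  rw [Nat.card_eq_fintype_card] at hN
  exact ⟨⟨V, H⟩, ⟨V, H, M, h, ⟨.refl⟩⟩, hN⟩

end SnarkFamily

/-! ### Values of `η` for classes -/

/-- It suffices to bound `η` from below on the class and to exhibit one extremal member. -/
theorem classEtaEq_of_forall {C : Set FinGraph} {r : ℝ} (h : ∀ G ∈ C, r ≤ eta G.graph)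
    {G : FinGraph} (hG : G ∈ C) (hr : eta G.graph ≤ r) : ClassEtaEq C r := by
  have : IsLeast ((fun G : FinGraph => eta G.graph) '' C) r := by
    refine ⟨⟨G, hG, le_antisymm hr (h G hG)⟩, ?_⟩
    rintro _ ⟨G', hG', rfl⟩
    exact h G' hG'
  exact ⟨this.csInf_eq, this⟩

theorem classEtaEq_petersenSnarkFamily : ClassEtaEq petersenSnarkFamily (1 / 3) := by
  obtain ⟨G, hG, -⟩ := exists_mem_petersenSnarkFamily_card_ge 0
  exact classEtaEq_of_forall (fun G hG => (isSnark_and_eta_of_mem_petersenSnarkFamily hG).2.ge) hG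
    (isSnark_and_eta_of_mem_petersenSnarkFamily hG).2.le

theorem classEtaEq_generalizedPetersenGraphs : ClassEtaEq generalizedPetersenGraphs (1 / 3) := by
  refine classEtaEq_of_forall (G := ⟨_, genPetersen 5 2⟩) ?_
    ⟨5, 2, by norm_num, by norm_num, by norm_num, ⟨.refl⟩⟩ petersen_isSparseMaximal.eta_le
  rintro G ⟨n, k, hn, hk, hkn, ⟨e⟩⟩
  exact third_le_eta_of_hasNoCutEdge ((genPetersen_isConnectedCubic hn hk hkn).of_iso e)
    ((genPetersen_hasNoCutEdge hn hk hkn).of_iso e)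

/-! ### Certifying planarity by straight line drawings -/

section StraightLine

variable {V : Type} {G : SimpleGraph V}

/-- Twice the signed area of the triangle `p q r`. -/
def orient (p q r : ℤ × ℤ) : ℤ :=
  (q.1 - p.1) * (r.2 - p.2) - (q.2 - p.2) * (r.1 - p.1)

/-- The line through `p` and `q` does not separate `r` from `s` and does not contain both. -/
def OnOneSide (p q r s : ℤ × ℤ) : Prop :=
  0 ≤ orient p q r * orient p q s ∧ ¬ (orient p q r = 0 ∧ orient p q s = 0)

instance (p q r s : ℤ × ℤ) : Decidable (OnOneSide p q r s) :=
  inferInstanceAs (Decidable (_ ∧ _))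

/-- The point that divides the segment from `p` to `q` in the ratio `t : 1 - t`. -/
def segPoint (p q : ℤ × ℤ) (t : ℝ) : ℝ × ℝ :=
  ((1 - t) * p.1 + t * q.1, (1 - t) * p.2 + t * q.2)

theorem segPoint_left_injective {p q : ℤ × ℤ} (h : p ≠ q) {s t : ℝ}
    (hst : segPoint p q s = segPoint p q t) : s = t := by
  simp only [segPoint, Prod.mk.injEq] at hst
  by_contra hne
  have h1 : (q.1 : ℝ) - p.1 = 0 := by
    have : (s - t) * ((q.1 : ℝ) - p.1) = 0 := by linear_combination hst.1
    exact (mul_eq_zero.mp this).resolve_left (sub_ne_zero.mpr hne)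
  have h2 : (q.2 : ℝ) - p.2 = 0 := by
    have : (s - t) * ((q.2 : ℝ) - p.2) = 0 := by linear_combination hst.2
    exact (mul_eq_zero.mp this).resolve_left (sub_ne_zero.mpr hne)
  apply h
  ext
  · have : (q.1 : ℝ) = p.1 := by linarith
    exact_mod_cast this.symm
  · have : (q.2 : ℝ) = p.2 := by linarith
    exact_mod_cast this.symm

/-- `orient p q` is affine in its last argument and vanishes on the line through `p` and `q`. -/
theorem orient_segPoint {p q r s : ℤ × ℤ} {t t' : ℝ} (h : segPoint p q t = segPoint r s t') :
    (1 - t') * (orient p q r : ℝ) + t' * (orient p q s : ℝ) = 0 := by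
  simp only [segPoint, Prod.mk.injEq] at h
  simp only [orient]
  push_cast
  linear_combination ((q.2 : ℝ) - p.2) * h.1 - ((q.1 : ℝ) - p.1) * h.2

/-- Two numbers of weakly equal sign, not both zero, have no vanishing combination with positive
coefficients. One endpoint may lie on the line, as happens for edges with a common end. -/
theorem OnOneSide.segPoint_ne {p q r s : ℤ × ℤ} (h : OnOneSide p q r s) {t t' : ℝ} (h0 : 0 < t')
    (h1 : t' < 1) : segPoint p q t ≠ segPoint r s t' := by
  intro heq
  have ho := orient_segPoint heq
  obtain ⟨hm, hn⟩ := h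
  have hm' : (0 : ℝ) ≤ (orient p q r : ℝ) * (orient p q s : ℝ) := by exact_mod_cast hm
  have h1' : 0 < 1 - t' := by linarith
  have hr : (orient p q r : ℝ) = 0 := by
    have : (1 - t') * (orient p q r : ℝ) ^ 2 +
        t' * ((orient p q r : ℝ) * (orient p q s : ℝ)) = 0 := by
      linear_combination (orient p q r : ℝ) * ho
    have h2 : (1 - t') * (orient p q r : ℝ) ^ 2 = 0 := by
      nlinarith [mul_nonneg h1'.le (sq_nonneg (orient p q r : ℝ)), mul_nonneg h0.le hm']
    simpa [h1'.ne'] using h2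
  have hs : (orient p q s : ℝ) = 0 := by
    rw [hr, mul_zero, zero_add] at ho
    exact (mul_eq_zero.mp ho).resolve_left h0.ne'
  exact hn ⟨by exact_mod_cast hr, by exact_mod_cast hs⟩

/-- A straight line drawing with integer coordinates. -/
theorem isPlanar_of_straightLine (P : V → ℤ × ℤ) (hP : Function.Injective P)
    (hv : ∀ a b, G.Adj a b → ∀ v, v ≠ a → v ≠ b → orient (P a) (P b) (P v) ≠ 0)
    (he : ∀ a b, G.Adj a b → ∀ c d, G.Adj c d → s(a, b) ≠ s(c, d) →
      OnOneSide (P a) (P b) (P c) (P d) ∨ OnOneSide (P c) (P d) (P a) (P b)) : IsPlanar G := by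
  have hends : ∀ e : G.edgeSet, ∃ u v, (e : Sym2 V) = s(u, v) := by
    rintro ⟨e, -⟩
    induction e with
    | h u v => exact ⟨u, v, rfl⟩
  choose u v huv using hends
  have hadj : ∀ e, G.Adj (u e) (v e) := by
    intro e
    have := e.2
    rwa [huv e] at this
  have hne : ∀ e, P (u e) ≠ P (v e) := fun e h => (hadj e).ne (hP h)
  have hcoe : ∀ p q : ℤ × ℤ, (((p.1 : ℝ), (p.2 : ℝ)) : ℝ × ℝ) = ((q.1 : ℝ), (q.2 : ℝ)) → p = q := by
    intro p q h
    rw [Prod.mk.injEq] at h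
    exact Prod.ext (by exact_mod_cast h.1) (by exact_mod_cast h.2)
  have hzero : ∀ p q : ℤ × ℤ, segPoint p q 0 = ((p.1 : ℝ), (p.2 : ℝ)) := by simp [segPoint]
  have hone : ∀ p q : ℤ × ℤ, segPoint p q 1 = ((q.1 : ℝ), (q.2 : ℝ)) := by simp [segPoint]
  refine ⟨{
    pos := fun w => ((P w).1, (P w).2)
    pos_injective := fun a b h => hP (hcoe _ _ h)
    arc := fun e t => segPoint (P (u e)) (P (v e)) t
    arc_continuous := fun e => by
      unfold segPoint
      fun_prop
    arc_injective := fun e s t h => Subtype.ext (segPoint_left_injective (hne e) h)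
    arc_ends := fun e => ⟨u e, v e, huv e, by simp [hzero], by simp [hone]⟩
    arc_ne_pos := ?_
    arc_ne_arc := ?_ }⟩
  · intro e t ht w h
    have h0 : (0 : ℝ) < t := ht.1
    have h1 : (t : ℝ) < 1 := ht.2
    by_cases hu : w = u e
    · rw [hu, ← hzero _ (P (v e))] at h
      exact h0.ne' (segPoint_left_injective (hne e) h)
    by_cases hv' : w = v e
    · rw [hv', ← hone (P (u e)) _] at h
      exact h1.ne (segPoint_left_injective (hne e) h)
    rw [← hzero _ (P w)] at h
    have := orient_segPoint h
    simp only [sub_zero, one_mul, zero_mul, add_zero] at this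
    exact hv _ _ (hadj e) w hu hv' (by exact_mod_cast this)
  · intro e f hef s hs t ht h
    have hef' : s(u e, v e) ≠ s(u f, v f) := by
      rw [← huv e, ← huv f]
      exact fun h => hef (Subtype.ext h)
    rcases he _ _ (hadj e) _ _ (hadj f) hef' with h' | h'
    · exact h'.segPoint_ne ht.1 ht.2 h
    · exact h'.segPoint_ne hs.1 hs.2 h.symm

end StraightLine

/-! ### A planar hamiltonian extremal graph -/

section Example

/-- The ends of the chords of the Hamiltonian cycle `0, 1, …, 9` in `chordGraph`. -/
def chord : Fin 10 → Fin 10 := ![4, 9, 7, 5, 0, 3, 8, 2, 6, 1]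

/-- A planar hamiltonian cubic graph with a sparse maximal matching: each edge of the tetrahedron
with vertices `0, 2, 5, 8` is subdivided, and the new vertices are matched along common faces. -/
def chordGraph : SimpleGraph (Fin 10) where
  Adj a b := b = a + 1 ∨ a = b + 1 ∨ b = chord a
  symm := ⟨by decide⟩
  loopless := ⟨by decide⟩

instance : DecidableRel chordGraph.Adj := fun a b =>
  inferInstanceAs (Decidable (b = a + 1 ∨ a = b + 1 ∨ b = chord a))

theorem chordGraph_isHamiltonian : chordGraph.IsHamiltonian := by
  refine SimpleGraph.IsHamiltonian.mono (G := SimpleGraph.cycleGraph (7 + 3)) ?_ fun _ =>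
    ⟨0, SimpleGraph.cycleGraph.cycle 7,
      SimpleGraph.Walk.isHamiltonianCycle_iff_isCycle_and_length_eq.mpr
        ⟨SimpleGraph.cycleGraph.isCycle_cycle, by simp⟩⟩
  intro a b
  revert a b
  decide

theorem chordGraph_isConnectedCubic : IsConnectedCubic chordGraph := by
  refine ⟨chordGraph_isHamiltonian.connected, fun v => ?_⟩
  rw [Set.ncard_eq_toFinset_card']
  revert v
  decide

theorem chordGraph_isEdgeColoring : IsEdgeColoring chordGraph fun a b =>
    if b = chord a then 2 else if b = a + 1 then (if a.val % 2 = 0 then 0 else 1)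
    else (if b.val % 2 = 0 then 0 else 1) where
  symm := by decide
  proper := by decide

theorem chordGraph_isSparseMaximal : IsSparseMaximal chordGraph fun a b =>
    (a, b) ∈ [(1, 9), (9, 1), (3, 4), (4, 3), (6, 7), (7, 6)] where
  symm := by decide
  adj := by decide
  unique := by decide
  indep := by decide
  card := by
    rw [Set.ncard_eq_toFinset_card', Nat.card_eq_fintype_card]
    decide

theorem chordGraph_isPlanar : IsPlanar chordGraph :=
  isPlanar_of_straightLine
    -- The vertices `0, …, 4` form a convex pentagon around the others.
    ![(8, 4), (5, 8), (1, 6), (1, 2), (5, 0), (2, 2), (4, 4), (2, 6), (4, 5), (6, 5)]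
    (by decide) (by decide) (by decide)

theorem eta_chordGraph_le : eta chordGraph ≤ 1 / 3 := chordGraph_isSparseMaximal.eta_le

theorem classEtaEq_taitColorableGraphs : ClassEtaEq taitColorableGraphs (1 / 3) :=
  classEtaEq_of_forall (G := ⟨_, chordGraph⟩) (fun _ h => IsTaitColorable.third_le_eta h)
    ((isTaitColorable_iff chordGraph_isConnectedCubic).mpr ⟨_, chordGraph_isEdgeColoring⟩)
    eta_chordGraph_le

theorem classEtaEq_planarBridgelessCubicGraphs :
    ClassEtaEq planarBridgelessCubicGraphs (1 / 3) :=
  classEtaEq_of_forall (G := ⟨_, chordGraph⟩)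
    (fun _ h => third_le_eta_of_hasNoCutEdge h.1 (isBridgeless_iff_hasNoCutEdge.mp h.2.1))
    ⟨chordGraph_isConnectedCubic, fun _ _ he => he.not_isHamiltonian chordGraph_isHamiltonian,
      chordGraph_isPlanar⟩
    eta_chordGraph_le

theorem classEtaEq_hamiltonianCubicGraphs : ClassEtaEq hamiltonianCubicGraphs (1 / 3) :=
  classEtaEq_of_forall (G := ⟨_, chordGraph⟩)
    (fun _ h => third_le_eta_of_isHamiltonian h.1 h.2)
    ⟨chordGraph_isConnectedCubic, chordGraph_isHamiltonian⟩ eta_chordGraph_le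

end Example

/-! ### Bipartite cubic graphs -/

section Bipartite

variable {V : Type} [Fintype V] [DecidableEq V]

/-- In the bipartite case the odd cut constraints are automatic. With signs `±1` for the two sides,
the signed count of an odd set is odd, hence at least 1 in absolute value; the values inside the set
cancel, so the cut bounds it. -/
theorem isFracPM_of_bipartite {x : V → V → ℝ} (h0 : ∀ a b, 0 ≤ x a b)
    (hs : ∀ a b, x a b = x b a) (hr : ∀ a, ∑ b, x a b = 1) (f : V → Bool)
    (hf : ∀ a b, x a b ≠ 0 → f a ≠ f b) : IsFracPM x where
  nonneg := h0
  symm := hs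
  diag a := by
    by_contra h
    exact hf a a h rfl
  row := hr
  odd A hA := by
    let s : V → ℤ := fun a => if f a then 1 else -1
    have hodd : Odd (∑ a ∈ A, s a) := by
      have h1 : ∑ a ∈ A, s a = 2 * ∑ a ∈ A, (if f a then 1 else 0) - A.card := by
        rw [Finset.mul_sum, Finset.card_eq_sum_ones, Nat.cast_sum, ← Finset.sum_sub_distrib]
        refine Finset.sum_congr rfl fun a _ => ?_
        simp only [s]
        split_ifs <;> norm_num
      have h2 : Odd (A.card : ℤ) := by exact_mod_cast hA
      rw [h1]
      exact (even_two_mul _).sub_odd h2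
    have habs : (1 : ℝ) ≤ |∑ a ∈ A, (s a : ℝ)| := by
      have h1 : 1 ≤ |∑ a ∈ A, s a| := by
        rw [← Int.zero_add 1, Int.add_one_le_iff, abs_pos]
        intro h
        rw [h] at hodd
        exact absurd hodd (by decide)
      exact_mod_cast h1
    have hin : ∑ a ∈ A, ∑ b ∈ A, (s a : ℝ) * x a b = 0 := by
      have h1 : ∑ a ∈ A, ∑ b ∈ A, (s a : ℝ) * x a b = ∑ a ∈ A, ∑ b ∈ A, (s b : ℝ) * x a b := by
        rw [Finset.sum_comm]
        simp_rw [hs]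
      have h2 : ∑ a ∈ A, ∑ b ∈ A, (s a : ℝ) * x a b +
          ∑ a ∈ A, ∑ b ∈ A, (s b : ℝ) * x a b = 0 := by
        simp_rw [← Finset.sum_add_distrib]
        refine Finset.sum_eq_zero fun a _ => Finset.sum_eq_zero fun b _ => ?_
        by_cases h : x a b = 0
        · simp [h]
        · have := hf a b h
          simp only [s]
          cases ha : f a <;> cases hb : f b <;> simp_all
      linarith
    have hsplit : ∑ a ∈ A, (s a : ℝ) = ∑ a ∈ A, ∑ b ∈ Aᶜ, (s a : ℝ) * x a b := by
      rw [← zero_add (∑ a ∈ A, ∑ b ∈ Aᶜ, (s a : ℝ) * x a b), ← hin, ← Finset.sum_add_distrib]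
      refine Finset.sum_congr rfl fun a _ => ?_
      rw [Finset.sum_add_sum_compl, ← Finset.mul_sum, hr, mul_one]
    rw [hsplit] at habs
    refine habs.trans ((Finset.abs_sum_le_sum_abs _ _).trans (Finset.sum_le_sum fun a _ =>
      (Finset.abs_sum_le_sum_abs _ _).trans (Finset.sum_le_sum fun b _ => ?_)))
    rw [abs_mul, abs_of_nonneg (h0 a b)]
    have : |(s a : ℝ)| = 1 := by
      simp only [s]
      split_ifs <;> simp
    rw [this, one_mul]

/-- The value `1 / m` on every edge is a fractional perfect matching, and its support contains a
perfect matching. -/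
theorem exists_pairing_of_regular_bipartite {R : V → V → Prop} (hs : ∀ a b, R a b → R b a)
    (f : V → Bool) (hf : ∀ a b, R a b → f a ≠ f b) {m : ℕ} (hm : m ≠ 0)
    (hR : ∀ a, {b | R a b}.ncard = m) : ∃ σ : V → V, IsPairing σ ∧ ∀ v, R v (σ v) := by
  classical
  have hx : IsFracPM fun a b => if R a b then (1 / m : ℝ) else 0 := by
    refine isFracPM_of_bipartite (fun a b => by positivity)
      (fun a b => by simp only [show R a b ↔ R b a from ⟨hs a b, hs b a⟩]) (fun a => ?_) f
      fun a b h => hf a b (by by_contra h'; simp [h'] at h)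
    have := hR a
    rw [Set.ncard_eq_toFinset_card', Set.toFinset_ofPred] at this
    rw [← Finset.sum_filter, Finset.sum_const, this, nsmul_eq_mul]
    field_simp
  obtain ⟨σ, hσ, hpos⟩ := hx.exists_pairing
  refine ⟨σ, hσ, fun v => ?_⟩
  by_contra h
  have := hpos v
  simp [h] at this

/-- Kőnig's edge colouring theorem for cubic bipartite graphs. -/
theorem isTaitColorable_of_isBipartite {G : SimpleGraph V} (hG : IsConnectedCubic G)
    (hb : G.IsBipartite) : IsTaitColorable G := by
  obtain ⟨C⟩ := hb
  let f : V → Bool := fun a => C a = 0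
  have hf : ∀ a b, G.Adj a b → f a ≠ f b := by
    intro a b hab
    have := C.valid hab
    simp only [f]
    generalize C a = p at *
    generalize C b = q at *
    revert p q
    decide
  have hdel : ∀ (R : V → V → Prop) (σ : V → V) (m : ℕ), (∀ v, R v (σ v)) →
      (∀ a, {b | R a b}.ncard = m + 1) → ∀ a, {b | R a b ∧ σ a ≠ b}.ncard = m := by
    intro R σ m hσ hR a
    have h1 : {b | R a b ∧ σ a ≠ b} = {b | R a b} \ {σ a} := by
      ext b
      simp [eq_comm]
    rw [h1, Set.ncard_sdiff_singleton_of_mem (show σ a ∈ {b | R a b} from hσ a), hR a]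
    rfl
  -- Remove two perfect matchings in turn; the remaining 1-regular relation is the third color
  -- class.
  obtain ⟨σ, hσ, hσG⟩ := exists_pairing_of_regular_bipartite (R := G.Adj)
    (fun _ _ h => h.symm) f hf three_ne_zero hG.2
  have h2 := hdel G.Adj σ 2 hσG hG.2
  obtain ⟨τ, hτ, hτG⟩ := exists_pairing_of_regular_bipartite (R := fun a b => G.Adj a b ∧ σ a ≠ b)
    (fun a b h => ⟨h.1.symm, fun h' => h.2 ((hσ.eq_comm_apply b a).mp h')⟩) f
    (fun a b h => hf a b h.1) two_ne_zero h2
  have h1 := hdel _ τ 1 hτG h2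
  rw [isTaitColorable_iff hG]
  refine ⟨fun a b => if σ a = b then 0 else if τ a = b then 1 else 2, fun a b _ => ?_,
    fun a b d hab had h => ?_⟩
  · simp only [hσ.eq_comm_apply a b, hτ.eq_comm_apply a b]
  · have hlast : σ a ≠ b → τ a ≠ b → σ a ≠ d → τ a ≠ d → b = d := by
      intro hb1 hb2 hd1 hd2
      obtain ⟨e, he⟩ := Set.ncard_eq_one.mp (h1 a)
      have hb' : b ∈ ({e} : Set V) := he ▸ ⟨⟨hab, hb1⟩, hb2⟩
      have hd' : d ∈ ({e} : Set V) := he ▸ ⟨⟨had, hd1⟩, hd2⟩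
      exact (Set.mem_singleton_iff.mp hb').trans (Set.mem_singleton_iff.mp hd').symm
    split_ifs at h <;> first | exact absurd h (by decide) | grind

end Bipartite

/-! ### A bipartite nonhamiltonian cubic graph with `η` at most 1/2 -/

section TripleLink

/-- Adjacency in `tripleLink`. -/
def tripleLinkAdj : Bool ⊕ (Fin 3 × Bool × Fin 3) → Bool ⊕ (Fin 3 × Bool × Fin 3) → Bool
  | .inl _, .inl _ => false
  | .inl s, .inr (_, t, j) => s = t ∧ j = 0
  | .inr (_, t, j), .inl s => s = t ∧ j = 0
  | .inr (i, s, j), .inr (k, t, l) => i = k ∧ s ≠ t ∧ ¬ (j = 0 ∧ l = 0)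

/-- Two vertices `Sum.inl false`, `Sum.inl true` linked by three copies of `K₃,₃` minus an edge;
the ends of the missing edge of copy `i` are the vertices `Sum.inr (i, _, 0)`. -/
def tripleLink : SimpleGraph (Bool ⊕ (Fin 3 × Bool × Fin 3)) where
  Adj a b := tripleLinkAdj a b
  symm := ⟨by decide⟩
  loopless := ⟨by decide⟩

instance : DecidableRel tripleLink.Adj := fun a b =>
  inferInstanceAs (Decidable (tripleLinkAdj a b))

theorem tripleLink_isConnectedCubic : IsConnectedCubic tripleLink := by
  constructor
  · have hub : ∀ s i, tripleLink.Adj (.inl s) (.inr (i, s, 0)) := by decide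
    have link : ∀ i s j j', ¬ (j = 0 ∧ j' = 0) →
        tripleLink.Adj (.inr (i, s, j)) (.inr (i, !s, j')) := by decide
    refine connected_of_forall_mem_iff fun S hS => ?_
    have h10 : ∀ i s, Sum.inr (i, s, 0) ∈ S ↔ Sum.inr (i, !s, 1) ∈ S := fun i s =>
      hS _ _ (link i s 0 1 (by decide))
    have h20 : ∀ i s, Sum.inr (i, s, 0) ∈ S ↔ Sum.inr (i, !s, 2) ∈ S := fun i s =>
      hS _ _ (link i s 0 2 (by decide))
    have h11 : ∀ i s, Sum.inr (i, s, 1) ∈ S ↔ Sum.inr (i, !s, 1) ∈ S := fun i s =>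
      hS _ _ (link i s 1 1 (by decide))
    have hub' : ∀ s i, Sum.inl s ∈ S ↔ Sum.inr (i, s, 0) ∈ S := fun s i => hS _ _ (hub s i)
    have h0 : ∀ i, Sum.inr (i, false, 0) ∈ S ↔ Sum.inr (i, true, 0) ∈ S := fun i =>
      (h10 i false).trans ((h11 i true).trans (h10 i true).symm)
    have hall : ∀ p, Sum.inl false ∈ S ↔ p ∈ S := by
      rintro (s | ⟨i, s, j⟩)
      · cases s
        · rfl
        · exact (hub' false 0).trans ((h0 0).trans (hub' true 0).symm)
      · have hz : ∀ s, Sum.inl false ∈ S ↔ Sum.inr (i, s, 0) ∈ S := by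
          intro s
          cases s
          · exact hub' false i
          · exact (hub' false i).trans (h0 i)
        rw [hz (!s)]
        have hj : j = 0 ∨ j = 1 ∨ j = 2 := by
          revert j
          decide
        rcases hj with rfl | rfl | rfl
        · rw [← hz, ← hz]
        · simpa using h10 i (!s)
        · simpa using h20 i (!s)
    exact fun a b => (hall a).symm.trans (hall b)
  · intro v
    rw [Set.ncard_eq_toFinset_card']
    revert v
    decide

theorem tripleLink_isBipartite : tripleLink.IsBipartite := by
  let C : tripleLink.Coloring Bool :=
    SimpleGraph.Coloring.mk (Sum.elim (fun s => !s) fun p => p.2.1) (by decide)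
  have := C.colorable
  simpa [SimpleGraph.IsBipartite] using this

/-- A perfect matching that enters a copy leaves it at the other end. -/
theorem tripleLink_pairing {σ : Bool ⊕ (Fin 3 × Bool × Fin 3) → Bool ⊕ (Fin 3 × Bool × Fin 3)}
    (hσ : IsPairing σ) (hadj : ∀ v, tripleLink.Adj v (σ v)) {i : Fin 3}
    (h : σ (.inl false) = .inr (i, false, 0)) : σ (.inl true) = .inr (i, true, 0) := by
  have hinj : Function.Injective σ := fun a b hab => by rw [← (hσ a).2, hab, (hσ b).2]
  have n0 : ∀ i p, tripleLink.Adj (.inr (i, true, 0)) p →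
      p = .inl true ∨ p = .inr (i, false, 1) ∨ p = .inr (i, false, 2) := by decide
  have n1 : ∀ i j p, j ≠ 0 → tripleLink.Adj (.inr (i, true, j)) p →
      p = .inr (i, false, 0) ∨ p = .inr (i, false, 1) ∨ p = .inr (i, false, 2) := by decide
  have hne : ∀ j, σ (.inr (i, true, j)) ≠ .inr (i, false, 0) := by
    intro j hj
    have := hinj (h.trans hj.symm)
    simp at this
  -- The hub has taken `(i, false, 0)`, so the vertices `(i, true, 1)` and `(i, true, 2)` use up the
  -- other two of the `false` side. Only the hub remains for `(i, true, 0)`.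
  have e1 := (n1 i 1 _ (by decide) (hadj _)).resolve_left (hne 1)
  have e2 := (n1 i 2 _ (by decide) (hadj _)).resolve_left (hne 2)
  have d01 : σ (.inr (i, true, 0)) ≠ σ (.inr (i, true, 1)) := fun h => by simpa using hinj h
  have d02 : σ (.inr (i, true, 0)) ≠ σ (.inr (i, true, 2)) := fun h => by simpa using hinj h
  have d12 : σ (.inr (i, true, 1)) ≠ σ (.inr (i, true, 2)) := fun h => by simpa using hinj h
  have e0 : σ (.inr (i, true, 0)) = .inl true := by
    rcases n0 i _ (hadj _) with e0 | e0 | e0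
    · exact e0
    all_goals
      rcases e1 with e1 | e1 <;> rcases e2 with e2 | e2 <;> simp_all
  rw [← e0, (hσ _).2]

/-- The edges outside a Hamiltonian cycle of a cubic graph form a perfect matching. It contains both
hub edges of some copy, and these are the only edges that leave the copy, so the cycle could not
reach it. -/
theorem tripleLink_not_isHamiltonian : ¬ tripleLink.IsHamiltonian := by
  intro hham
  obtain ⟨a, p, hp⟩ := hham (by decide)
  set C := p.toSubgraph with hC
  have hdeg : ∀ v, (C.neighborSet v).ncard = 2 := fun v =>
    hp.isCycle.ncard_neighborSet_toSubgraph_eq_two (hp.mem_support v)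
  have huniq : ∀ v, ∃ b, tripleLink.neighborSet v \ C.neighborSet v = {b} := by
    intro v
    rw [← Set.ncard_eq_one, Set.ncard_sdiff (C.neighborSet_subset v), hdeg,
      tripleLink_isConnectedCubic.2]
  choose σ hσ using huniq
  have hσmem : ∀ v, tripleLink.Adj v (σ v) ∧ ¬ C.Adj v (σ v) := by
    intro v
    have : σ v ∈ tripleLink.neighborSet v \ C.neighborSet v := by rw [hσ]; rfl
    exact this
  have hσu : ∀ v b, tripleLink.Adj v b → ¬ C.Adj v b → b = σ v := by
    intro v b h1 h2
    have : b ∈ tripleLink.neighborSet v \ C.neighborSet v := ⟨h1, h2⟩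
    rwa [hσ] at this
  have hpair : IsPairing σ := fun v =>
    ⟨(hσmem v).1.ne', (hσu _ _ (hσmem v).1.symm fun h => (hσmem v).2 h.symm).symm⟩
  have nhub : ∀ q, tripleLink.Adj (.inl false) q → ∃ i, q = .inr (i, false, 0) := by decide
  obtain ⟨i, hi⟩ := nhub _ (hσmem (.inl false)).1
  have hi' := tripleLink_pairing hpair (fun v => (hσmem v).1) hi
  have hhub : ∀ s, ¬ C.Adj (.inl s) (.inr (i, s, 0)) := by
    intro s
    cases s
    · exact hi ▸ (hσmem _).2
    · exact hi' ▸ (hσmem _).2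
  have hleave : ∀ i t j d, tripleLink.Adj (.inr (i, t, j)) d →
      (∃ t' j', d = .inr (i, t', j')) ∨ j = 0 ∧ d = .inl t := by decide
  let S : Set (Bool ⊕ (Fin 3 × Bool × Fin 3)) := {c | ∃ t j, c = .inr (i, t, j)}
  have hS : ∀ c d, C.Adj c d → c ∈ S → d ∈ S := by
    rintro c d hcd ⟨t, j, rfl⟩
    refine (hleave i t j d hcd.adj_sub).resolve_right ?_
    rintro ⟨rfl, rfl⟩
    exact hhub t hcd.symm
  have hconn : C.coe.Connected := p.toSubgraph_connected.coe
  have hverts : ∀ v, v ∈ C.verts := fun v => by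
    rw [hC, SimpleGraph.Walk.mem_verts_toSubgraph]
    exact hp.mem_support v
  have := (mem_iff_of_connected hconn (S := Subtype.val ⁻¹' S)
    (fun c d hcd => ⟨hS c d hcd, hS d c (SimpleGraph.Subgraph.Adj.symm hcd)⟩)
    ⟨.inr (i, false, 0), hverts _⟩ ⟨.inl false, hverts _⟩).mp ⟨_, _, rfl⟩
  obtain ⟨_, _, hq⟩ := this
  simp at hq

-- The test matching joins the two hubs to different copies. A perfect matching uses the same copy
-- at both hubs, so it contains at most one of the two edges, that is, two of the four covered
-- vertices.
set_option synthInstance.maxSize 2000 in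
set_option synthInstance.maxHeartbeats 200000 in
theorem eta_tripleLink_le : eta tripleLink ≤ 1 / 2 := by
  have hvert : ∀ v w : Bool ⊕ (Fin 3 × Bool × Fin 3),
      s(v, w) = s(.inl false, .inr (0, false, 0)) ∨ s(v, w) = s(.inl true, .inr (1, true, 0)) →
      v = .inl false ∨ v = .inr (0, false, 0) ∨ v = .inl true ∨ v = .inr (1, true, 0) := by
    decide
  have hmate : ∀ v : Bool ⊕ (Fin 3 × Bool × Fin 3),
      v = .inl false ∨ v = .inr (0, false, 0) ∨ v = .inl true ∨ v = .inr (1, true, 0) →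
      ∃ w, (s(v, w) = s(.inl false, .inr (0, false, 0)) ∨
        s(v, w) = s(.inl true, .inr (1, true, 0))) ∧
        ∀ y, (s(v, y) = s(.inl false, .inr (0, false, 0)) ∨
          s(v, y) = s(.inl true, .inr (1, true, 0))) → y = w := by
    decide
  let M : tripleLink.Subgraph :=
    { verts := {.inl false, .inr (0, false, 0), .inl true, .inr (1, true, 0)}
      Adj := fun a b => s(a, b) = s(.inl false, .inr (0, false, 0)) ∨
        s(a, b) = s(.inl true, .inr (1, true, 0))
      adj_sub := by decide
      edge_vert := fun h => hvert _ _ h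
      symm := ⟨fun a b h => by rwa [Sym2.eq_swap]⟩ }
  have hM : M.IsMatching := fun v hv => hmate v hv
  have hverts : M.verts.ncard = 4 := by
    rw [Set.ncard_eq_toFinset_card']
    simp only [M]
    decide
  refine eta_le_of_matching hM ⟨s(.inl false, .inr (0, false, 0)), ?_⟩ (by norm_num)
    fun σ hσ hadj => ?_
  · exact Or.inl rfl
  · rw [hverts]
    have hends : ∀ {v a b}, s(v, σ v) = s(a, b) → σ a = b ∧ (v = a ∨ v = b) := by
      intro v a b h
      rcases Sym2.eq_iff.mp h with ⟨rfl, h'⟩ | ⟨rfl, h'⟩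
      · exact ⟨h', .inl rfl⟩
      · exact ⟨(hσ.eq_comm_apply _ _).mp h', .inr rfl⟩
    have hsub : ∃ a b, {v | M.Adj v (σ v)} ⊆ {a, b} := by
      by_cases h : σ (.inl false) = .inr (0, false, 0)
      · have h' := tripleLink_pairing hσ hadj h
        refine ⟨.inl false, .inr (0, false, 0), ?_⟩
        rintro v (hv | hv)
        · exact (hends hv).2
        · have := (hends hv).1
          rw [h'] at this
          simp at this
      · refine ⟨.inl true, .inr (1, true, 0), ?_⟩
        rintro v (hv | hv)
        · exact absurd (hends hv).1 h
        · exact (hends hv).2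
    obtain ⟨a, b, hab⟩ := hsub
    have h2 : {v | M.Adj v (σ v)}.ncard ≤ 2 :=
      (Set.ncard_le_ncard hab (Set.toFinite _)).trans ((Set.ncard_insert_le a {b}).trans (by simp))
    have h3 : ({v | M.Adj v (σ v)}.ncard : ℝ) ≤ 2 := by exact_mod_cast h2
    push_cast
    linarith

theorem tripleLink_mem : (⟨_, tripleLink⟩ : FinGraph) ∈ bipartiteNonhamiltonianCubicGraphs :=
  ⟨tripleLink_isConnectedCubic, tripleLink_isBipartite, tripleLink_not_isHamiltonian⟩

theorem bipartiteNonhamiltonianCubicGraphs_subset :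
    bipartiteNonhamiltonianCubicGraphs ⊆ taitColorableGraphs := fun _ h =>
  isTaitColorable_of_isBipartite h.1 h.2.1

theorem third_mem_lowerBounds_bipartite :
    1 / 3 ∈ lowerBounds
      ((fun G : FinGraph => eta G.graph) '' bipartiteNonhamiltonianCubicGraphs) := by
  rintro _ ⟨G, hG, rfl⟩
  exact (bipartiteNonhamiltonianCubicGraphs_subset hG).third_le_eta

end TripleLink

end CostOfPerfection

end

open CostOfPerfection in
theorem mainTheorem1 :
    ClassEtaEq taitColorableGraphs (1 / 3) ∧
    ClassEtaEq planarBridgelessCubicGraphs (1 / 3) ∧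
    ClassEtaEq hamiltonianCubicGraphs (1 / 3) ∧
    ClassEtaEq generalizedPetersenGraphs (1 / 3) ∧
    (ClassEtaEq petersenSnarkFamily (1 / 3) ∧
      (∀ G ∈ petersenSnarkFamily, IsSnark G.graph ∧ eta G.graph = 1 / 3) ∧
      (∀ N : ℕ, ∃ G ∈ petersenSnarkFamily, N ≤ Fintype.card G.V)) ∧
    (bipartiteNonhamiltonianCubicGraphs ⊆ taitColorableGraphs ∧
      1 / 3 ≤ classEta bipartiteNonhamiltonianCubicGraphs ∧
      classEta bipartiteNonhamiltonianCubicGraphs ≤ 1 / 2 ∧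
      ∃ G ∈ bipartiteNonhamiltonianCubicGraphs, eta G.graph ≤ 1 / 2) := by
  refine ⟨classEtaEq_taitColorableGraphs, classEtaEq_planarBridgelessCubicGraphs,
    classEtaEq_hamiltonianCubicGraphs, classEtaEq_generalizedPetersenGraphs,
    ⟨classEtaEq_petersenSnarkFamily, fun _ h => isSnark_and_eta_of_mem_petersenSnarkFamily h,
      exists_mem_petersenSnarkFamily_card_ge⟩,
    bipartiteNonhamiltonianCubicGraphs_subset, ?_, ?_, ⟨_, tripleLink_mem, eta_tripleLink_le⟩⟩
  · exact le_csInf ⟨_, _, tripleLink_mem, rfl⟩ third_mem_lowerBounds_bipartite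
  · exact (csInf_le ⟨_, third_mem_lowerBounds_bipartite⟩ ⟨_, tripleLink_mem, rfl⟩).trans
      eta_tripleLink_le
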